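/- Let $d\ge 1$, $L>0$, let $X=(\mathbb R/L\mathbb Z)^d$ be the periodic box of volume $V=L^d$, and let $G:X\to\mathbb R$ be a continuous function such that the operator $(\hat G j)(x)=\int_X G(x-y)\,j(y)\,dy$ on the real Hilbert space $L^2(X)$ has an orthonormal eigenbasis $(e_k)$ with eigenvalues $\lambda_k>0$, $\sum_k\lambda_k<\infty$ (so $\hat G$ is positive, injective and trace class). Let $\mu_G$ be the centred Gaussian measure on $L^2(X)$ with covariance operator $\hat G$, that is, the law of $\sum_k\sqrt{\lambda_k}\,\xi_k e_k$ with independent standard normal $\xi_k$. For $1\le\alpha\le 2$, $g>0$ and $j\in L^2(X)$ put $$Z[j]=\int e^{-g\int_X|\phi(x)|^\alpha dx-\int_X j(x)\phi(x)\,dx}\,d\mu_G(\phi),\qquad Z_0[j]=e^{\frac12\int_X\int_X j(x)G(x-y)j(y)\,dx\,dy},\qquad \varphi=\hat G j .$$ For $x=(x_1,\dots,x_n)\in X^n$ let $G_n=(G(x_a-x_b))_{a,b=1}^n$, and let $$Z_{I,n}[j]=\frac{(-g)^n}{n!}\int_{X^n}dx\int_{\mathbb R^n}d\phi\;\prod_{a=1}^n|\phi_a|^\alpha\;\frac{1}{\sqrt{(2\pi)^n\det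 G_n}}\exp\Big\{-\tfrac12\sum_{a,b=1}^n(G_n^{-1})_{ab}\,[\phi_a-\varphi(x_a)]\,[\phi_b-\varphi(x_b)]\Big\}.$$ Then: 1. The functional integral $Z[j]$ converges for all $j$; so does the one without interaction ($g=0$), and the latter equals $Z_0[j]$. 2. For every $n$ the matrix $G_n$ is positive definite for almost every $x\in X^n$, and the integral defining $Z_{I,n}[j]$ converges absolutely, as an integral over $X^n\times\mathbb R^n$. Moreover $Z_{I,0}[j]=1$. 3. (Majorant.) For all $n\ge1$, $R\ge0$ and all $j$ with $\|j\|_{L^2}\le R$, $$|Z_{I,n}[j]|\le M_n(R):=c_n\, g^n\, G(0)^{n\alpha/2}\,V^n\,\big(1+\sqrt{\|\hat G\|}\,R\big)\,e^{\frac12\|\hat G\|R^2},\qquad c_n=\frac{1}{n!}\,\frac{n\,\pi^{n/2}\,2^{(n\alpha+n)/2}\,\Gamma(n(\alpha+1))^{1/2}}{\Gamma(\frac n2+1)},$$ where $\|\hat G\|$ is the operator norm on $L^2(X)$. There is a constant $A$ depending only on $\alpha$ with $c_n\le A^n n^{n\alpha/2-n}$ for all $n\ge1$; if $\alpha<2$,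 then $\sum_{n\ge1} M_n(R)<\infty$ for every $R$. 4. If $\alpha<2$ ($g>0$ arbitrary), or if $\alpha=2$ and $2g\|\hat G\|<1$, then for every $j\in L^2(X)$ $$\frac{Z[j]}{Z_0[j]}=\sum_{n=0}^\infty Z_{I,n}[j],$$ with absolute convergence, and the partial sums converge uniformly for $j$ in every bounded subset of $L^2(X)$. -/

import Mathlib

open MeasureTheory ProbabilityTheory Filter Topology
open scoped Matrix

noncomputable section

namespace FractionalQFT

/-- The periodic box: the `d`-dimensional cube of edge `L` with opposite faces identified. Its
reference measure `volume` is Lebesgue measure, of total mass `L ^ d`. -/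
abbrev Box (d : ℕ) (L : ℝ) : Type := Fin d → AddCircle L

/-- The real Hilbert space of square-integrable periodic fields. -/
abbrev FieldSpace (d : ℕ) (L : ℝ) [Fact (0 < L)] : Type :=
  Lp ℝ 2 (volume : Measure (Box d L))

instance (d : ℕ) (L : ℝ) [Fact (0 < L)] : MeasurableSpace (FieldSpace d L) := borel _

instance (d : ℕ) (L : ℝ) [Fact (0 < L)] : BorelSpace (FieldSpace d L) := ⟨rfl⟩

variable {d : ℕ} {L : ℝ} [Fact (0 < L)]

theorem integrable_field (j : FieldSpace d L) : Integrable (fun y => j y) volume :=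
  (Lp.memLp j).integrable (by norm_num)

theorem integrable_kernel_mul (G : C(Box d L, ℝ)) (j : FieldSpace d L) (x : Box d L) :
    Integrable (fun y => G (x - y) * j y) volume := by
  refine (integrable_field j).bdd_mul (c := ‖G‖) ?_ ?_
  · exact (by fun_prop : Continuous fun y => G (x - y)).aestronglyMeasurable
  · exact Filter.Eventually.of_forall fun y => G.norm_coe_le_norm _

theorem continuous_kernel_integral (G : C(Box d L, ℝ)) (j : FieldSpace d L) :
    Continuous fun x => ∫ y, G (x - y) * j y := by
  refine continuous_of_dominated (bound := fun y => ‖G‖ * ‖j y‖) ?_ ?_ ?_ ?_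
  · exact fun x => (integrable_kernel_mul G j x).aestronglyMeasurable
  · intro x
    refine Filter.Eventually.of_forall fun y => ?_
    rw [norm_mul]
    exact mul_le_mul_of_nonneg_right (G.norm_coe_le_norm _) (norm_nonneg _)
  · exact (integrable_field j).norm.const_mul _
  · exact Filter.Eventually.of_forall fun y => by fun_prop

/-- The classical field `x ↦ ∫ G (x - y) j (y) dy` of the source `j`. -/
def classicalField (G : C(Box d L, ℝ)) (j : FieldSpace d L) : C(Box d L, ℝ) where
  toFun x := ∫ y, G (x - y) * j y
  continuous_toFun := continuous_kernel_integral G j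

theorem classicalField_apply_eq_inner (G : C(Box d L, ℝ)) (j : FieldSpace d L) (x : Box d L) :
    classicalField G j x =
      inner ℝ (ContinuousMap.toLp 2 volume ℝ (G.comp ⟨fun y => x - y, by fun_prop⟩)) j := by
  rw [L2.inner_def]
  refine integral_congr_ae ?_
  filter_upwards [ContinuousMap.coeFn_toLp (p := 2) (𝕜 := ℝ) (volume : Measure (Box d L))
    (G.comp ⟨fun y => x - y, by fun_prop⟩)] with y hy
  rw [hy]
  simp [mul_comm]

theorem norm_classicalField_le (G : C(Box d L, ℝ)) (j : FieldSpace d L) :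
    ‖classicalField G j‖ ≤
      ‖(ContinuousMap.toLp 2 volume ℝ : C(Box d L, ℝ) →L[ℝ] FieldSpace d L)‖ * ‖G‖ * ‖j‖ := by
  rw [ContinuousMap.norm_le _ (by positivity)]
  intro x
  rw [classicalField_apply_eq_inner]
  refine (norm_inner_le_norm _ _).trans (mul_le_mul_of_nonneg_right ?_ (norm_nonneg _))
  refine (ContinuousLinearMap.le_opNorm _ _).trans
    (mul_le_mul_of_nonneg_left ?_ (norm_nonneg _))
  rw [ContinuousMap.norm_le _ (norm_nonneg _)]
  exact fun y => G.norm_coe_le_norm _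

/-- The operator on the field space with kernel `G (x - y)`. -/
def propagatorOp (G : C(Box d L, ℝ)) : FieldSpace d L →L[ℝ] FieldSpace d L :=
  LinearMap.mkContinuous
    { toFun := fun j => ContinuousMap.toLp 2 volume ℝ (classicalField G j)
      map_add' := fun j₁ j₂ => by
        rw [← map_add]
        congr 1
        ext x
        simp only [ContinuousMap.add_apply, classicalField_apply_eq_inner, inner_add_right]
      map_smul' := fun c j => by
        rw [RingHom.id_apply, ← map_smul]
        congr 1
        ext x
        simp only [ContinuousMap.smul_apply, classicalField_apply_eq_inner, inner_smul_right,
          smul_eq_mul] }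
    (‖(ContinuousMap.toLp 2 volume ℝ : C(Box d L, ℝ) →L[ℝ] FieldSpace d L)‖ *
      (‖(ContinuousMap.toLp 2 volume ℝ : C(Box d L, ℝ) →L[ℝ] FieldSpace d L)‖ * ‖G‖))
    (fun j => by
      refine ((ContinuousMap.toLp 2 volume ℝ : C(Box d L, ℝ) →L[ℝ] FieldSpace d L).le_opNorm
        (classicalField G j)).trans ?_
      rw [mul_assoc]
      exact mul_le_mul_of_nonneg_left (norm_classicalField_le G j) (norm_nonneg _))

/-- The centred Gaussian measure on the field space whose covariance operator has the orthonormal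
eigenbasis `e` and the eigenvalues `lam`: the law of `∑ₖ √(lam k) ξₖ eₖ` with independent standard
normal coefficients `ξₖ`. For summable `lam` the series converges almost surely, and the
coordinates in the basis `e` are independent with densities
`(2 π lam k) ^ (-1 / 2) exp (- t ^ 2 / (2 lam k))`. -/
def gaussianMeasure (e : HilbertBasis ℕ ℝ (FieldSpace d L)) (lam : ℕ → ℝ) :
    Measure (FieldSpace d L) :=
  (Measure.infinitePi fun _ : ℕ => gaussianReal 0 1).map
    fun ξ => ∑' k, (Real.sqrt (lam k) * ξ k) • e k

/-- The weight `exp (- g ∫ |φ| ^ α dx - ∫ j φ dx)`. -/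
def weight (α g : ℝ) (j φ : FieldSpace d L) : ℝ :=
  Real.exp (-g * (∫ x, |φ x| ^ α) - ∫ x, j x * φ x)

/-- The generating functional `Z[j]` of the theory with interaction `g |φ| ^ α` and Gaussian
reference measure `μ`. -/
def genFunctional (μ : Measure (FieldSpace d L)) (α g : ℝ) (j : FieldSpace d L) : ℝ :=
  ∫ φ, weight α g j φ ∂μ

/-- The Gaussian generating functional `Z₀[j] = exp (½ ∫∫ j(x) G(x - y) j(y) dx dy)`. -/
def gaussGenFunctional (G : C(Box d L, ℝ)) (j : FieldSpace d L) : ℝ :=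
  Real.exp ((1 / 2) * ∫ x, ∫ y, j x * G (x - y) * j y)

/-- The matrix `Gₙ` with entries `G (x_a - x_b)`. -/
def covMatrix (G : C(Box d L, ℝ)) {n : ℕ} (x : Fin n → Box d L) : Matrix (Fin n) (Fin n) ℝ :=
  Matrix.of fun a b => G (x a - x b)

/-- The integrand of the `n`-th order: `∏ |φ_a| ^ α` times the Gaussian density with covariance
matrix `Gₙ` and mean vector the values of the classical field at the points `x_a`. -/
def termIntegrand (G : C(Box d L, ℝ)) (α : ℝ) (j : FieldSpace d L) {n : ℕ}
    (x : Fin n → Box d L) (φ : Fin n → ℝ) : ℝ :=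
  (∏ a, |φ a| ^ α) *
    (1 / Real.sqrt ((2 * Real.pi) ^ n * (covMatrix G x).det)) *
    Real.exp (-(1 / 2) * ∑ a, ∑ b, (covMatrix G x)⁻¹ a b *
      (φ a - classicalField G j (x a)) * (φ b - classicalField G j (x b)))

/-- The `n`-th term of the perturbation series in powers of `g`. -/
def seriesTerm (G : C(Box d L, ℝ)) (α g : ℝ) (n : ℕ) (j : FieldSpace d L) : ℝ :=
  (-g) ^ n / (n.factorial : ℝ) *
    ∫ x : Fin n → Box d L, ∫ φ : Fin n → ℝ, termIntegrand G α j x φ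

/-- The numerical coefficient of the majorant (used for `1 ≤ n`). -/
def majorantCoeff (α : ℝ) (n : ℕ) : ℝ :=
  (1 / (n.factorial : ℝ)) *
    (n * Real.pi ^ ((n : ℝ) / 2) * 2 ^ ((n * α + n) / 2) *
      Real.sqrt (Real.Gamma (n * (α + 1))) / Real.Gamma ((n : ℝ) / 2 + 1))

/-- The majorant of the `n`-th term (used for `1 ≤ n`) on the ball of sources of norm at
most `R`. -/
def majorant (G : C(Box d L, ℝ)) (α g : ℝ) (n : ℕ) (R : ℝ) : ℝ :=
  majorantCoeff α n * g ^ n * G 0 ^ (n * α / 2) * (L ^ d) ^ n *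
    ((1 + Real.sqrt ‖propagatorOp G‖ * R) * Real.exp ((1 / 2) * ‖propagatorOp G‖ * R ^ 2))

end FractionalQFT

end

/-!
The generating functional of a Gaussian field with interaction `g ∫ |φ| ^ α` is expanded in powers
of `g`.

The whole argument takes place on one probability space, the space of sequences `ω` of independent
standard normal variables. The isonormal process `W(a) = ∑ₖ aₖ ωₖ` maps `ℓ²` isometrically into
`L²` of this space. The free field `∑ₖ √λₖ ωₖ eₖ` has the law `gaussianMeasure e lam`; its pairing
with a source `j` is `W(sourceVec j)`, and its value at a point `x` is `W(fieldVec x)`, where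
`fieldVec x` is a square-summable sequence by Mercer's inequality
(`Diagonalizes.sum_sq_classicalField_le`). Mercer's theorem (`Diagonalizes.inner_fieldVec`) says
that `⟪fieldVec x, fieldVec y⟫ = G (x - y)`, so `covMatrix G x` is the Gram matrix of the field
vectors. It is positive definite for almost every `x` (`Diagonalizes.ae_posDef_covMatrix`): if the
field vectors of a set of positive measure lay in a finite-dimensional space, so would the source
vectors of all fields supported there, against the injectivity of the propagator.

Since `∫ j φ = W(sourceVec j)`, the source enters through the density `exp (-W(sourceVec j))`, whose
normalising constant is `Z₀[j]`. Tilting white noise by this density leaves the covariance alone and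
shifts the mean of `φ(x)` by minus the classical field (`map_tiltedNoise`). Hence `Z[j] / Z₀[j]` is
the expectation of `exp (-g ∫ |φ| ^ α)` under the tilted noise. By Fubini's theorem, applied to a
jointly measurable version of the field (`Diagonalizes.exists_measurable_field`), the `n`-th moment
of `∫ |φ| ^ α` is the integral over `n` points of a Gaussian integral in `n` variables, which after
the reflection `φ ↦ -φ` is that of the `n`-th term (`Diagonalizes.seriesTerm_eq`). So the series is
the exponential series, integrated term by term, and everything reduces to summable bounds for the
moments which are uniform for `j` in a ball.

For `α < 2` such a bound comes from Hölder's inequality over the `n` points and the Cauchy–Schwarz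
inequality against the tilt, which leave an absolute moment of order `2 n α` of a single Gaussian
variable; Gamma function estimates bring it under the majorant
(`Diagonalizes.abs_seriesTerm_le_majorant`), which is at most a geometric factor times
`n ^ ((α / 2 - 1) n)`. For `α = 2` the interaction is `‖φ‖² = ∑ₖ λₖ ωₖ²`. Its exponential moments of order `s`
factorise over the modes and are finite when `2 s ‖propagatorOp G‖ < 1`; by Hölder's inequality they
remain finite under the tilt, and an order slightly above `g` makes the terms decay geometrically
(`Diagonalizes.exists_summable_bound_quadratic`).
-/

noncomputable section

open scoped ENNReal NNReal

namespace FractionalQFT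

/-! ### White noise and its isonormal process -/

section WhiteNoise

/-- Almost everywhere representative of a finite linear combination in `L²`. -/
theorem coeFn_sum_smul_ae {X : Type*} [MeasurableSpace X] {μ : Measure X} (u : ℕ → Lp ℝ 2 μ)
    {f : ℕ → X → ℝ} (hu : ∀ k, u k =ᵐ[μ] f k) (c : ℕ → ℝ) (N : ℕ) :
    (∑ k ∈ Finset.range N, c k • u k : Lp ℝ 2 μ) =ᵐ[μ]
      fun x => ∑ k ∈ Finset.range N, c k * f k x := by
  have h1 : ∀ᵐ x ∂μ, ∀ k, (c k • u k : Lp ℝ 2 μ) x = c k * f k x := by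
    rw [ae_all_iff]
    intro k
    filter_upwards [Lp.coeFn_smul (c k) (u k), hu k] with x h1 h2
    rw [h1, Pi.smul_apply, h2, smul_eq_mul]
  filter_upwards [Lp.coeFn_finsetSum (Finset.range N) (fun k => c k • u k), h1] with x h2 h3
  rw [h2, Finset.sum_apply]
  exact Finset.sum_congr rfl fun k _ => h3 k

/-- If a series converges in `L²` and a subsequence of its partial sums converges almost
everywhere, the limits agree. -/
theorem ae_eq_of_hasSum_of_tendsto {X : Type*} [MeasurableSpace X] {μ : Measure X}
    [IsFiniteMeasure μ] {u : ℕ → Lp ℝ 2 μ} {f : ℕ → X → ℝ} (hu : ∀ k, u k =ᵐ[μ] f k) {c : ℕ → ℝ}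
    {U : Lp ℝ 2 μ} (hU : HasSum (fun k => c k • u k) U) {ns : ℕ → ℕ} (hns : StrictMono ns)
    {V : X → ℝ} (hV : ∀ᵐ x ∂μ, Tendsto (fun i => ∑ k ∈ Finset.range (ns i), c k * f k x) atTop
      (𝓝 (V x))) : U =ᵐ[μ] V := by
  have h1 : TendstoInMeasure μ (fun (N : ℕ) x => ∑ k ∈ Finset.range N, c k * f k x) atTop U :=
    (tendstoInMeasure_of_tendsto_Lp hU.tendsto_sum_nat).congr
      (fun N => coeFn_sum_smul_ae u hu c N) (ae_eq_refl _)
  refine tendstoInMeasure_ae_unique (h1.comp hns.tendsto_atTop) ?_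
  refine tendstoInMeasure_of_tendsto_ae (fun i => ?_) hV
  exact (Lp.aestronglyMeasurable _).congr (coeFn_sum_smul_ae u hu c (ns i))

/-- The law of a sequence of independent standard normal variables. -/
abbrev whiteNoise : Measure (ℕ → ℝ) := Measure.infinitePi fun _ : ℕ => gaussianReal 0 1

/-- The Hilbert space of square-summable real sequences. -/
abbrev SeqSpace : Type := lp (fun _ : ℕ => ℝ) 2

theorem map_eval_whiteNoise (k : ℕ) : whiteNoise.map (fun ω => ω k) = gaussianReal 0 1 :=
  (measurePreserving_eval_infinitePi (fun _ : ℕ => gaussianReal 0 1) k).map_eq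

theorem iIndepFun_eval_whiteNoise : iIndepFun (fun (k : ℕ) (ω : ℕ → ℝ) => ω k) whiteNoise :=
  iIndepFun_infinitePi (P := fun _ : ℕ => gaussianReal 0 1) (X := fun _ x => x) (by fun_prop)

theorem memLp_eval_whiteNoise (k : ℕ) : MemLp (fun ω : ℕ → ℝ => ω k) 2 whiteNoise := by
  have h : MemLp (id : ℝ → ℝ) 2 (whiteNoise.map (fun ω => ω k)) := by
    rw [map_eval_whiteNoise]; exact memLp_id_gaussianReal' 2 (by norm_num)
  exact h.comp_of_map (measurable_pi_apply k).aemeasurable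

theorem integral_eval_mul_eval_whiteNoise (k l : ℕ) :
    ∫ ω, ω k * ω l ∂whiteNoise = if k = l then 1 else 0 := by
  have hm : ∀ k, ∫ ω, ω k ∂whiteNoise = 0 := fun k => by
    have h := integral_map (μ := whiteNoise) (φ := fun ω => ω k) (f := fun x : ℝ => x)
      (measurable_pi_apply k).aemeasurable (by fun_prop)
    rw [map_eval_whiteNoise, integral_id_gaussianReal] at h
    exact h.symm
  split_ifs with h
  · subst h
    have h := integral_map (μ := whiteNoise) (φ := fun ω => ω k) (f := fun x : ℝ => x * x)
      (measurable_pi_apply k).aemeasurable (by fun_prop)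
    have h2 : Var[fun x : ℝ => x; gaussianReal 0 1] = 1 := by simp
    rw [variance_of_integral_eq_zero (by fun_prop) (by simp)] at h2
    rw [map_eval_whiteNoise] at h
    rw [← h, ← h2]
    simp [pow_two]
  · have := (iIndepFun_eval_whiteNoise.indepFun h).integral_mul_eq_mul_integral
      (memLp_eval_whiteNoise k).aestronglyMeasurable (memLp_eval_whiteNoise l).aestronglyMeasurable
    simp only [Pi.mul_apply] at this
    rw [show (∫ ω, ω k * ω l ∂whiteNoise) = _ from this, hm, zero_mul]

/-- The `k`-th coordinate as an element of `L²` of the white noise. -/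
def coordL2 (k : ℕ) : Lp ℝ 2 whiteNoise := (memLp_eval_whiteNoise k).toLp

theorem coordL2_ae (k : ℕ) : coordL2 k =ᵐ[whiteNoise] fun ω => ω k :=
  (memLp_eval_whiteNoise k).coeFn_toLp

theorem orthonormal_coordL2 : Orthonormal ℝ coordL2 := by
  rw [orthonormal_iff_ite]
  intro k l
  rw [L2.inner_def, ← integral_eval_mul_eval_whiteNoise]
  refine integral_congr_ae ?_
  filter_upwards [coordL2_ae k, coordL2_ae l] with ω h1 h2
  simp [h1, h2, mul_comm]

/-- The isonormal process `W(a) = ∑ₖ aₖ ωₖ`, a linear isometry from `ℓ²` to `L²` of the white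
noise. Each `isonormal a` is thus a class of functions up to null sets, so that linearity in `a`
holds only almost surely. -/
def isonormal : SeqSpace →ₗᵢ[ℝ] Lp ℝ 2 whiteNoise :=
  orthonormal_coordL2.orthogonalFamily.linearIsometry

theorem hasSum_isonormal (a : SeqSpace) : HasSum (fun k => a k • coordL2 k) (isonormal a) := by
  simpa using! orthonormal_coordL2.orthogonalFamily.hasSum_linearIsometry a

theorem tendstoInMeasure_isonormal (a : SeqSpace) :
    TendstoInMeasure whiteNoise (fun (N : ℕ) ω => ∑ k ∈ Finset.range N, a k * ω k) atTop
      (isonormal a) := by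
  have h := tendstoInMeasure_of_tendsto_Lp (hasSum_isonormal a).tendsto_sum_nat
  exact h.congr (fun N => coeFn_sum_smul_ae coordL2 coordL2_ae a N) (ae_eq_refl _)

/-- Any almost sure limit of the partial sums along a subsequence is the isonormal process. -/
theorem isonormal_ae_eq_of_tendsto (a : SeqSpace) {X : (ℕ → ℝ) → ℝ} {ns : ℕ → ℕ}
    (hns : StrictMono ns) (hX : ∀ᵐ ω ∂whiteNoise,
      Tendsto (fun i => ∑ k ∈ Finset.range (ns i), a k * ω k) atTop (𝓝 (X ω))) :
    isonormal a =ᵐ[whiteNoise] X :=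
  ae_eq_of_hasSum_of_tendsto coordL2_ae (hasSum_isonormal a) hns hX

theorem hasSum_sq_norm_sq (a : SeqSpace) : HasSum (fun k => a k ^ 2) (‖a‖ ^ 2) := by
  have h := lp.hasSum_inner (𝕜 := ℝ) a a
  rw [real_inner_self_eq_norm_sq] at h
  simpa [pow_two] using h

/-- The characteristic functional of finitely many coordinates, by independence. -/
theorem integral_cexp_sum_eval (c : ℕ → ℝ) (N : ℕ) :
    ∫ ω : ℕ → ℝ, Complex.exp ((∑ k ∈ Finset.range N, c k * ω k : ℝ) * Complex.I) ∂whiteNoise =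
      Complex.exp (-(∑ k ∈ Finset.range N, c k ^ 2 : ℝ) / 2) := by
  have h1 : ∀ k (t : ℝ), ∫ ω : ℕ → ℝ, Complex.exp ((t * ω k : ℝ) * Complex.I) ∂whiteNoise =
      Complex.exp (-(t ^ 2 : ℝ) / 2) := by
    intro k t
    have h := charFun_gaussianReal (μ := 0) (v := 1) t
    rw [← map_eval_whiteNoise k, charFun_apply_real,
      integral_map (measurable_pi_apply k).aemeasurable (by fun_prop)] at h
    push_cast
    rw [h]; congr 1; push_cast; ring
  have hind : iIndepFun (fun (k : ℕ) (ω : ℕ → ℝ) =>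
      Complex.exp ((c k * ω k : ℝ) * Complex.I)) whiteNoise :=
    iIndepFun_eval_whiteNoise.comp (fun k x => Complex.exp ((c k * x : ℝ) * Complex.I))
      (fun k => by fun_prop)
  have h2 := (hind.precomp (g := fun i : Finset.range N => (i : ℕ))
    Subtype.val_injective).integral_fun_prod_eq_prod_integral
    (fun i => by
      exact (by fun_prop : Measurable _).aestronglyMeasurable)
  simp only [h1, Finset.prod_coe_sort (Finset.range N) (fun k => Complex.exp (-(c k ^ 2 : ℝ) / 2)),
    ← Complex.exp_sum] at h2
  rw [← Finset.sum_div, Finset.sum_neg_distrib] at h2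
  push_cast at h2 ⊢
  rw [← h2]
  refine integral_congr_ae (Eventually.of_forall fun ω => ?_)
  simp only
  rw [Finset.sum_coe_sort (Finset.range N) (fun k => ((c k : ℂ) * ω k * Complex.I)), Finset.sum_mul]

/-- The characteristic functional of the isonormal process, the limit of the finite-dimensional
ones along an almost surely convergent subsequence of the partial sums. -/
theorem integral_cexp_isonormal (a : SeqSpace) :
    ∫ ω, Complex.exp ((isonormal a ω : ℝ) * Complex.I) ∂whiteNoise =
      Complex.exp (-(‖a‖ ^ 2 : ℝ) / 2) := by
  obtain ⟨ns, hns, hlim⟩ := (tendstoInMeasure_isonormal a).exists_seq_tendsto_ae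
  have hL : Tendsto (fun i => ∫ ω : ℕ → ℝ, Complex.exp
      ((∑ k ∈ Finset.range (ns i), a k * ω k : ℝ) * Complex.I) ∂whiteNoise) atTop
      (𝓝 (∫ ω, Complex.exp ((isonormal a ω : ℝ) * Complex.I) ∂whiteNoise)) := by
    refine tendsto_integral_of_dominated_convergence (fun _ => 1) (fun i => ?_)
      (integrable_const _) (fun i => Eventually.of_forall fun ω => ?_) ?_
    · exact (by fun_prop : Measurable _).aestronglyMeasurable
    · rw [Complex.norm_exp_ofReal_mul_I]
    · filter_upwards [hlim] with ω hω
      exact ((Complex.continuous_exp.comp (by fun_prop : Continuous fun x : ℝ =>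
        (x : ℂ) * Complex.I)).tendsto _).comp hω
  refine tendsto_nhds_unique hL ?_
  simp_rw [integral_cexp_sum_eval]
  have h := (hasSum_sq_norm_sq a).tendsto_sum_nat.comp hns.tendsto_atTop
  exact ((by fun_prop : Continuous fun x : ℝ => Complex.exp (-(x : ℂ) / 2)).tendsto _).comp h

theorem measurable_isonormal (a : SeqSpace) : Measurable (isonormal a) :=
  (Lp.stronglyMeasurable _).measurable

theorem map_isonormal (a : SeqSpace) :
    whiteNoise.map (isonormal a) = gaussianReal 0 (‖a‖₊ ^ 2) := by
  have := Measure.isProbabilityMeasure_map (μ := whiteNoise) (measurable_isonormal a).aemeasurable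
  refine Measure.ext_of_charFun (funext fun t => ?_)
  rw [charFun_gaussianReal, charFun_apply_real,
    integral_map (measurable_isonormal a).aemeasurable (by fun_prop)]
  have h := integral_cexp_isonormal (t • a)
  rw [norm_smul, mul_pow] at h
  convert h using 1
  · refine integral_congr_ae ?_
    rw [map_smul]
    filter_upwards [Lp.coeFn_smul t (isonormal a)] with ω hω
    rw [hω]; simp
  · congr 1
    push_cast
    simp only [Real.norm_eq_abs, ← Complex.ofReal_pow, sq_abs]
    push_cast; ring

theorem isonormal_linear_comb_ae (s t : ℝ) (a b : SeqSpace) :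
    isonormal (s • a + t • b) =ᵐ[whiteNoise] fun ω => s * isonormal a ω + t * isonormal b ω := by
  rw [map_add, map_smul, map_smul]
  filter_upwards [Lp.coeFn_add (s • isonormal a) (t • isonormal b),
    Lp.coeFn_smul s (isonormal a), Lp.coeFn_smul t (isonormal b)] with ω h1 h2 h3
  rw [h1, Pi.add_apply, h2, h3]; rfl

/-- Orthogonal vectors give independent Gaussian variables: the joint characteristic function
factorises. -/
theorem indepFun_isonormal {a b : SeqSpace} (h : inner ℝ a b = 0) :
    IndepFun (isonormal a) (isonormal b) whiteNoise := by
  rw [indepFun_iff_charFun_prod (measurable_isonormal a).aemeasurable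
    (measurable_isonormal b).aemeasurable]
  intro t
  rw [map_isonormal, map_isonormal, charFun_gaussianReal, charFun_gaussianReal, ← Complex.exp_add,
    charFun_apply, integral_map (by
      exact (WithLp.measurable_toLp 2 _).comp_aemeasurable
        ((measurable_isonormal a).prodMk (measurable_isonormal b)).aemeasurable) (by fun_prop)]
  have h1 := integral_cexp_isonormal (t.ofLp.1 • a + t.ofLp.2 • b)
  have h2 : ‖t.ofLp.1 • a + t.ofLp.2 • b‖ ^ 2 =
      t.ofLp.1 ^ 2 * ‖a‖ ^ 2 + t.ofLp.2 ^ 2 * ‖b‖ ^ 2 := by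
    rw [norm_add_sq_real, real_inner_smul_left, real_inner_smul_right, h, norm_smul, norm_smul,
      mul_pow, mul_pow]
    simp
  rw [h2] at h1
  convert h1 using 1
  · refine integral_congr_ae ?_
    filter_upwards [isonormal_linear_comb_ae t.ofLp.1 t.ofLp.2 a b] with ω hω
    rw [hω]
    simp [WithLp.prod_inner_apply]
  · congr 1
    push_cast
    ring

theorem integrable_exp_isonormal (a : SeqSpace) (t : ℝ) :
    Integrable (fun ω => Real.exp (t * isonormal a ω)) whiteNoise := by
  have h := integrable_exp_mul_gaussianReal (μ := 0) (v := ‖a‖₊ ^ 2) t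
  rw [← map_isonormal] at h
  exact h.comp_measurable (measurable_isonormal a)

theorem integral_exp_isonormal (a : SeqSpace) (t : ℝ) :
    ∫ ω, Real.exp (t * isonormal a ω) ∂whiteNoise = Real.exp (t ^ 2 * ‖a‖ ^ 2 / 2) := by
  have h := mgf_gaussianReal (map_isonormal a) t
  rw [mgf] at h
  rw [h]
  congr 1
  push_cast
  ring

/-- The characteristic function of the isonormal process under an exponential tilt: completing the
square shifts the mean by minus the covariance. -/
theorem integral_cexp_isonormal_mul_exp (a b : SeqSpace) :
    ∫ ω, Complex.exp ((isonormal a ω : ℝ) * Complex.I) * (Real.exp (-isonormal b ω) : ℝ)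
        ∂whiteNoise =
      Complex.exp (-(‖a‖ ^ 2 : ℝ) / 2 - (inner ℝ a b : ℝ) * Complex.I + (‖b‖ ^ 2 : ℝ) / 2) := by
  -- split off from `a` its component along `b`; the rest is independent of the tilt
  obtain ⟨c, a', rfl, hab⟩ : ∃ (c : ℝ) (a' : SeqSpace), a = (1 : ℝ) • a' + c • b ∧
      inner ℝ a' b = 0 := by
    refine ⟨inner ℝ a b / ‖b‖ ^ 2, a - (inner ℝ a b / ‖b‖ ^ 2) • b, by simp, ?_⟩
    rw [inner_sub_left, real_inner_smul_left, real_inner_self_eq_norm_sq]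
    by_cases hb : b = 0
    · simp [hb]
    · have : ‖b‖ ^ 2 ≠ 0 := by simpa using hb
      field_simp; simp
  have hind := (indepFun_isonormal hab).comp
    (φ := fun x : ℝ => Complex.exp (x * Complex.I))
    (ψ := fun x : ℝ => Complex.exp ((c * Complex.I - 1) * x)) (by fun_prop) (by fun_prop)
  have h1 := hind.integral_mul_eq_mul_integral
    ((by fun_prop : Measurable fun x : ℝ => Complex.exp (x * Complex.I)).comp
      (measurable_isonormal a')).aestronglyMeasurable
    ((by fun_prop : Measurable fun x : ℝ => Complex.exp ((c * Complex.I - 1) * x)).comp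
      (measurable_isonormal b)).aestronglyMeasurable
  have h2 := complexMGF_gaussianReal (map_isonormal b) (c * Complex.I - 1)
  rw [complexMGF] at h2
  simp only [Function.comp_apply, Pi.mul_apply, Function.comp_def] at h1
  rw [integral_cexp_isonormal, h2, ← Complex.exp_add] at h1
  have h3 : ‖(1 : ℝ) • a' + c • b‖ ^ 2 = ‖a'‖ ^ 2 + c ^ 2 * ‖b‖ ^ 2 := by
    rw [norm_add_sq_real, real_inner_smul_left, real_inner_smul_right, hab, norm_smul, norm_smul,
      mul_pow, mul_pow]
    simp
  have h4 : inner ℝ ((1 : ℝ) • a' + c • b) b = c * ‖b‖ ^ 2 := by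
    rw [inner_add_left, real_inner_smul_left, real_inner_smul_left, hab,
      real_inner_self_eq_norm_sq]
    simp
  rw [h3, h4]
  convert h1 using 1
  · refine integral_congr_ae ?_
    filter_upwards [isonormal_linear_comb_ae 1 c a' b] with ω hω
    rw [hω]
    simp only [Complex.ofReal_exp, ← Complex.exp_add]
    congr 1
    push_cast; ring
  · congr 1
    push_cast
    ring_nf
    simp only [Complex.I_sq]
    ring

end WhiteNoise

/-! ### The Lebesgue density of a multivariate Gaussian -/

section GaussianDensity

open scoped MatrixOrder

/-- The density of the standard Gaussian measure, from the Fourier transform of a Gaussian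
function. -/
theorem stdGaussian_eq_withDensity (n : ℕ) :
    stdGaussian (EuclideanSpace ℝ (Fin n)) = volume.withDensity fun v =>
      ENNReal.ofReal ((Real.sqrt ((2 * Real.pi) ^ n))⁻¹ * Real.exp (-(1 / 2) * ‖v‖ ^ 2)) := by
  have hint : Integrable (fun v : EuclideanSpace ℝ (Fin n) =>
      (Real.sqrt ((2 * Real.pi) ^ n))⁻¹ * Real.exp (-(1 / 2) * ‖v‖ ^ 2)) := by
    refine Integrable.const_mul ?_ _
    have h := (GaussianFourier.integrable_cexp_neg_mul_sq_norm_add (V := EuclideanSpace ℝ (Fin n))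
      (b := 1 / 2) (by norm_num) 0 0).re
    refine h.congr (Eventually.of_forall fun v => ?_)
    have : (-(1 / 2 : ℂ) * (‖v‖ : ℂ) ^ 2 + 0 * ((inner ℝ 0 v : ℝ) : ℂ)) =
        ((-(1 / 2) * ‖v‖ ^ 2 : ℝ) : ℂ) := by push_cast; ring
    simp only [this, ← Complex.ofReal_exp]
    rfl
  have hfin := isFiniteMeasure_withDensity_ofReal hint.2
  refine Measure.ext_of_charFun (funext fun t => ?_)
  rw [charFun_stdGaussian, charFun_apply, integral_withDensity_eq_integral_toReal_smul
    (by fun_prop) (Eventually.of_forall fun _ => ENNReal.ofReal_lt_top)]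
  have h := GaussianFourier.integral_cexp_neg_mul_sq_norm_add (V := EuclideanSpace ℝ (Fin n))
      (b := 1 / 2) (by norm_num) Complex.I t
  have hs : ((Real.sqrt ((2 * Real.pi) ^ n) : ℝ) : ℂ) =
      (Real.pi / (1 / 2) : ℂ) ^ (Module.finrank ℝ (EuclideanSpace ℝ (Fin n)) / 2 : ℂ) := by
    rw [Real.sqrt_eq_rpow, ← Real.rpow_natCast, ← Real.rpow_mul (by positivity),
      Complex.ofReal_cpow (by positivity)]
    simp only [finrank_euclideanSpace, Fintype.card_fin]
    push_cast
    congr 1 <;> ring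
  rw [← hs] at h
  have hne : ((Real.sqrt ((2 * Real.pi) ^ n) : ℝ) : ℂ) ≠ 0 := by
    rw [Complex.ofReal_ne_zero]; positivity
  calc Complex.exp (-(‖t‖ : ℂ) ^ 2 / 2) = ((Real.sqrt ((2 * Real.pi) ^ n) : ℝ) : ℂ)⁻¹ *
        ∫ v : EuclideanSpace ℝ (Fin n), Complex.exp (-(1 / 2) * (‖v‖ : ℂ) ^ 2 +
          Complex.I * (inner ℝ t v : ℝ)) := by
        rw [h, ← mul_assoc, inv_mul_cancel₀ hne, one_mul]
        congr 1
        rw [Complex.I_sq]; ring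
    _ = _ := by
        rw [← integral_const_mul]
        refine integral_congr_ae (Eventually.of_forall fun v => ?_)
        simp only
        rw [ENNReal.toReal_ofReal (by positivity), Complex.exp_add, Complex.real_smul,
          real_inner_comm]
        push_cast
        ring_nf

/-- Integration against a nondegenerate multivariate Gaussian measure, in terms of its density. The
measure is the image of the standard one under `x ↦ m + √C x`, so this is a linear change of
variables with Jacobian `det √C`. -/
theorem lintegral_multivariateGaussian {n : ℕ} {C : Matrix (Fin n) (Fin n) ℝ} (hC : C.PosDef)
    (m : Fin n → ℝ) {f : (Fin n → ℝ) → ℝ≥0∞} (hf : Measurable f) :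
    ∫⁻ y, f (WithLp.ofLp y) ∂multivariateGaussian (WithLp.toLp 2 m) C =
      ∫⁻ φ, f φ * ENNReal.ofReal (1 / Real.sqrt ((2 * Real.pi) ^ n * C.det) *
        Real.exp (-(1 / 2) * ∑ a, ∑ b, C⁻¹ a b * (φ a - m a) * (φ b - m b))) := by
  set S : Matrix (Fin n) (Fin n) ℝ := CFC.sqrt C with hS
  have hSS : S * S = C := CFC.sqrt_mul_sqrt_self _ hC.posSemidef.nonneg
  have hST : Sᵀ = S := by
    have := (CFC.sqrt_nonneg C).isSelfAdjoint.star_eq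
    rwa [Matrix.star_eq_conjTranspose, Matrix.conjTranspose_eq_transpose_of_trivial] at this
  have hdet : S.det * S.det = C.det := by rw [← Matrix.det_mul, hSS]
  have hCdet := hC.det_pos
  have hSdet : S.det ≠ 0 := fun h => by rw [h] at hdet; simp at hdet; exact hCdet.ne hdet
  have hquad : ∀ x : Fin n → ℝ, ∑ a, ∑ b, C⁻¹ a b * (S *ᵥ x) a * (S *ᵥ x) b = ∑ a, x a ^ 2 := by
    intro x
    have h1 : ∑ a, ∑ b, C⁻¹ a b * (S *ᵥ x) a * (S *ᵥ x) b = (S *ᵥ x) ⬝ᵥ (C⁻¹ *ᵥ (S *ᵥ x)) := by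
      generalize S *ᵥ x = y
      simp only [dotProduct, Matrix.mulVec, Finset.mul_sum]
      refine Finset.sum_congr rfl fun a _ => Finset.sum_congr rfl fun b _ => ?_
      ring
    have h2 : S * (C⁻¹ * S) = 1 := by
      have hu : IsUnit S.det := hSdet.isUnit
      rw [← hSS, Matrix.mul_inv_rev, Matrix.mul_assoc, Matrix.nonsing_inv_mul _ hu,
        Matrix.mul_one, Matrix.mul_nonsing_inv _ hu]
    rw [h1, Matrix.dotProduct_mulVec, ← Matrix.mulVec_transpose, Matrix.mulVec_mulVec,
      Matrix.transpose_nonsing_inv, ← hSS, Matrix.transpose_mul, hST]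
    rw [hSS, Matrix.dotProduct_mulVec, ← Matrix.mulVec_transpose, hST, Matrix.mulVec_mulVec, h2,
      Matrix.one_mulVec]
    simp [dotProduct, pow_two]
  have hsqrt : Real.sqrt ((2 * Real.pi) ^ n * C.det) =
      Real.sqrt ((2 * Real.pi) ^ n) * |S.det| := by
    rw [Real.sqrt_mul (by positivity), ← hdet, Real.sqrt_mul_self_eq_abs]
  have hmS : Measurable (Matrix.toLin' S) :=
    (Matrix.toLin' S).continuous_of_finiteDimensional.measurable
  -- both sides become integrals of `f (m + S x)` against the standard density
  rw [multivariateGaussian, lintegral_map (by fun_prop) (by fun_prop), stdGaussian_eq_withDensity,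
    lintegral_withDensity_eq_lintegral_mul _ (by fun_prop) (by fun_prop),
    ← (EuclideanSpace.volume_preserving_symm_measurableEquiv_toLp (Fin n)).symm.lintegral_comp
      (by fun_prop)]
  have hmap := Real.map_matrix_volume_pi_eq_smul_volume_pi hSdet
  have hvol : (volume : Measure (Fin n → ℝ)) =
      ENNReal.ofReal |S.det| • Measure.map (Matrix.toLin' S) volume := by
    rw [hmap, smul_smul, ← ENNReal.ofReal_mul (abs_nonneg _), ← abs_mul, mul_inv_cancel₀ hSdet]
    simp
  have hmd : Measurable fun φ : Fin n → ℝ => f φ * ENNReal.ofReal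
      (1 / Real.sqrt ((2 * Real.pi) ^ n * C.det) *
        Real.exp (-(1 / 2) * ∑ a, ∑ b, C⁻¹ a b * (φ a - m a) * (φ b - m b))) := by fun_prop
  have hgen : ∀ F : (Fin n → ℝ) → ℝ≥0∞, Measurable F →
      ∫⁻ φ, F φ = ∫⁻ x, ENNReal.ofReal |S.det| * F (m + Matrix.toLin' S x) := by
    intro F hF
    have hF' := hF.comp (measurable_const_add m)
    have h1 := lintegral_const_mul (μ := volume) (ENNReal.ofReal |S.det|) (hF'.comp hmS)
    simp only [Function.comp_apply] at h1
    have h2 := lintegral_map (μ := volume) hF' hmS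
    simp only [Function.comp_apply] at h2
    rw [← lintegral_add_left_eq_self F m, h1, ← h2]
    conv_lhs => rw [hvol, lintegral_smul_measure]
    rfl
  rw [hgen _ hmd]
  refine lintegral_congr fun x => ?_
  simp only [Pi.mul_apply, Matrix.toLin'_apply, Pi.add_apply, add_sub_cancel_left, hquad]
  have hx : ‖(MeasurableEquiv.toLp 2 (Fin n → ℝ)) x‖ ^ 2 = ∑ a, x a ^ 2 := by
    rw [EuclideanSpace.real_norm_sq_eq]; rfl
  have harg : (WithLp.toLp 2 m + Matrix.toEuclideanCLM (𝕜 := ℝ) S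
      ((MeasurableEquiv.toLp 2 (Fin n → ℝ)) x)).ofLp = m + S *ᵥ x := rfl
  rw [← hS]
  simp only [MeasurableEquiv.symm_symm] at *
  rw [harg, hx, mul_comm, mul_left_comm, ← ENNReal.ofReal_mul (abs_nonneg _), hsqrt]
  have h1 : |S.det| ≠ 0 := abs_ne_zero.2 hSdet
  have h2 : |S.det| * (1 / (Real.sqrt ((2 * Real.pi) ^ n) * |S.det|)) =
      (Real.sqrt ((2 * Real.pi) ^ n))⁻¹ := by field_simp
  rw [← mul_assoc |S.det|, h2]

end GaussianDensity

/-! ### The Cameron–Martin tilt of white noise -/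

section Tilt

/-- The normalised density `exp (-W(b)) / E[exp (-W(b))]` for the isonormal process `W`; the
normalising constant is `exp (‖b‖² / 2)`. -/
def tilt (b : SeqSpace) (ω : ℕ → ℝ) : ℝ := Real.exp (-isonormal b ω - ‖b‖ ^ 2 / 2)

theorem tilt_nonneg (b : SeqSpace) (ω : ℕ → ℝ) : 0 ≤ tilt b ω := (Real.exp_pos _).le

theorem measurable_tilt (b : SeqSpace) : Measurable (tilt b) :=
  (((measurable_isonormal b).neg).sub_const _).exp

theorem integrable_tilt (b : SeqSpace) : Integrable (tilt b) whiteNoise := by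
  have h := (integrable_exp_isonormal b (-1)).mul_const (Real.exp (-(‖b‖ ^ 2 / 2)))
  refine h.congr (Eventually.of_forall fun ω => ?_)
  simp only [tilt, ← Real.exp_add]
  ring_nf

theorem integral_tilt (b : SeqSpace) : ∫ ω, tilt b ω ∂whiteNoise = 1 := by
  have h := integral_exp_isonormal b (-1)
  calc ∫ ω, tilt b ω ∂whiteNoise
      = ∫ ω, Real.exp (-1 * isonormal b ω) * Real.exp (-(‖b‖ ^ 2 / 2)) ∂whiteNoise := by
        congr 1; ext ω; rw [tilt, ← Real.exp_add]; ring_nf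
    _ = 1 := by rw [integral_mul_const, h, ← Real.exp_add]; simp

/-- The white noise tilted by `exp (-W(b))`: by the Cameron–Martin theorem, white noise with mean
`-b`. -/
def tiltedNoise (b : SeqSpace) : Measure (ℕ → ℝ) :=
  whiteNoise.withDensity fun ω => ENNReal.ofReal (tilt b ω)

instance (b : SeqSpace) : IsProbabilityMeasure (tiltedNoise b) := by
  constructor
  rw [tiltedNoise, withDensity_apply _ MeasurableSet.univ, Measure.restrict_univ,
    ← ofReal_integral_eq_lintegral_ofReal (integrable_tilt b)
      (Eventually.of_forall (tilt_nonneg b)), integral_tilt, ENNReal.ofReal_one]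

theorem lintegral_tiltedNoise (b : SeqSpace) (f : (ℕ → ℝ) → ℝ≥0∞) (hf : Measurable f) :
    ∫⁻ ω, f ω ∂tiltedNoise b = ∫⁻ ω, f ω * ENNReal.ofReal (tilt b ω) ∂whiteNoise := by
  rw [tiltedNoise, lintegral_withDensity_eq_lintegral_mul _
    (measurable_tilt b).ennreal_ofReal hf]
  simp_rw [Pi.mul_apply, mul_comm]

theorem tiltedNoise_absolutelyContinuous (b : SeqSpace) : tiltedNoise b ≪ whiteNoise :=
  withDensity_absolutelyContinuous _ _

theorem isonormal_sum_ae {n : ℕ} (t : Fin n → ℝ) (v : Fin n → SeqSpace) :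
    isonormal (∑ a, t a • v a) =ᵐ[whiteNoise] fun ω => ∑ a, t a * isonormal (v a) ω := by
  rw [map_sum]
  have h1 := Lp.coeFn_finsetSum Finset.univ (fun a => isonormal (t a • v a))
  have h2 : ∀ᵐ ω ∂whiteNoise, ∀ a, isonormal (t a • v a) ω = t a * isonormal (v a) ω := by
    rw [ae_all_iff]
    intro a
    rw [map_smul]
    filter_upwards [Lp.coeFn_smul (t a) (isonormal (v a))] with ω hω
    rw [hω]; rfl
  filter_upwards [h1, h2] with ω h1 h2
  rw [h1, Finset.sum_apply]
  exact Finset.sum_congr rfl fun a _ => h2 a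

/-- Under the tilt by `b`, finitely many values of the isonormal process are jointly Gaussian; the
covariance is unchanged and the mean is shifted by minus the covariance with `b`. -/
theorem map_tiltedNoise {n : ℕ} (b : SeqSpace) (v : Fin n → SeqSpace) :
    (tiltedNoise b).map (fun ω => WithLp.toLp 2 fun a => isonormal (v a) ω) =
      multivariateGaussian (WithLp.toLp 2 fun a => -inner ℝ (v a) b) (Matrix.gram ℝ v) := by
  have hmeas : Measurable fun ω : ℕ → ℝ => (WithLp.toLp 2 fun a => isonormal (v a) ω :
      EuclideanSpace ℝ (Fin n)) :=
    (WithLp.measurable_toLp 2 _).comp (measurable_pi_lambda _ fun a => measurable_isonormal (v a))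
  have := Measure.isProbabilityMeasure_map (μ := tiltedNoise b) hmeas.aemeasurable
  refine Measure.ext_of_charFun (funext fun t => ?_)
  rw [charFun_multivariateGaussian (Matrix.posSemidef_gram ℝ v), charFun_apply,
    integral_map hmeas.aemeasurable (by fun_prop), tiltedNoise,
    integral_withDensity_eq_integral_toReal_smul (measurable_tilt b).ennreal_ofReal
      (Eventually.of_forall fun _ => ENNReal.ofReal_lt_top)]
  have h := integral_cexp_isonormal_mul_exp (∑ a, t a • v a) b
  have hnorm : ‖∑ a, t a • v a‖ ^ 2 = t.ofLp ⬝ᵥ Matrix.gram ℝ v *ᵥ t.ofLp := by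
    rw [← real_inner_self_eq_norm_sq, sum_inner]
    simp only [inner_sum, real_inner_smul_left, real_inner_smul_right, dotProduct, Matrix.mulVec,
      Matrix.gram_apply, Finset.mul_sum]
    refine Finset.sum_congr rfl fun a _ => Finset.sum_congr rfl fun c _ => ?_
    ring
  have hinner : inner ℝ (∑ a, t a • v a) b =
      -inner ℝ t (WithLp.toLp 2 fun a => -inner ℝ (v a) b) := by
    rw [sum_inner, PiLp.inner_apply, ← Finset.sum_neg_distrib]
    refine Finset.sum_congr rfl fun a _ => ?_
    rw [real_inner_smul_left]
    simp [mul_comm]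
  calc _ = ∫ ω, (Complex.exp ((isonormal (∑ a, t a • v a) ω : ℝ) * Complex.I) *
        (Real.exp (-isonormal b ω) : ℝ)) * Complex.exp (-(‖b‖ ^ 2 / 2 : ℝ)) ∂whiteNoise := by
        refine integral_congr_ae ?_
        filter_upwards [isonormal_sum_ae t.ofLp v] with ω hω
        rw [hω, ENNReal.toReal_ofReal (tilt_nonneg b ω), tilt, sub_eq_add_neg, Real.exp_add,
          Complex.real_smul, PiLp.inner_apply]
        push_cast
        simp only [RCLike.inner_apply, conj_trivial]
        push_cast
        ring
    _ = _ := by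
        rw [integral_mul_const, h, ← Complex.exp_add, hnorm, hinner]
        congr 1
        push_cast
        ring

/-- The joint density of finitely many values of the tilted isonormal process. -/
theorem lintegral_isonormal_tilt {n : ℕ} (b : SeqSpace) (v : Fin n → SeqSpace)
    (hv : (Matrix.gram ℝ v).PosDef) {f : (Fin n → ℝ) → ℝ≥0∞} (hf : Measurable f) :
    ∫⁻ ω, f (fun a => isonormal (v a) ω) ∂tiltedNoise b =
      ∫⁻ φ, f φ * ENNReal.ofReal (1 / Real.sqrt ((2 * Real.pi) ^ n * (Matrix.gram ℝ v).det) *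
        Real.exp (-(1 / 2) * ∑ a, ∑ c, (Matrix.gram ℝ v)⁻¹ a c *
          (φ a - -inner ℝ (v a) b) * (φ c - -inner ℝ (v c) b))) := by
  have hmeas : Measurable fun ω : ℕ → ℝ => (WithLp.toLp 2 fun a => isonormal (v a) ω :
      EuclideanSpace ℝ (Fin n)) :=
    (WithLp.measurable_toLp 2 _).comp (measurable_pi_lambda _ fun a => measurable_isonormal (v a))
  rw [← lintegral_multivariateGaussian hv _ hf, ← map_tiltedNoise,
    lintegral_map (by fun_prop) hmeas]

/-- The value of `E |ξ| ^ q` for a standard normal variable `ξ`. -/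
theorem lintegral_abs_rpow_gaussianReal {q : ℝ} (hq : 0 ≤ q) :
    ∫⁻ x, ENNReal.ofReal (|x| ^ q) ∂gaussianReal 0 1 =
      ENNReal.ofReal (2 ^ (q / 2) * Real.Gamma ((q + 1) / 2) / Real.sqrt Real.pi) := by
  have hint : Integrable (fun x : ℝ => |x| ^ q) (gaussianReal 0 1) := by
    have h := (memLp_id_gaussianReal' (μ := 0) (v := 1) (ENNReal.ofReal q)
      ENNReal.ofReal_ne_top).integrable_norm_rpow'
    simpa [ENNReal.toReal_ofReal hq] using h
  rw [← ofReal_integral_eq_lintegral_ofReal hint (Eventually.of_forall fun x => by positivity)]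
  congr 1
  rw [integral_gaussianReal_eq_integral_smul one_ne_zero]
  have h1 : ∀ x : ℝ, gaussianPDFReal 0 1 x • |x| ^ q =
      (fun y : ℝ => (Real.sqrt (2 * Real.pi))⁻¹ *
        (y ^ q * Real.exp (-(1 / 2) * y ^ (2 : ℝ)))) |x| := by
    intro x
    simp only [gaussianPDFReal, smul_eq_mul, Real.rpow_two, sq_abs]
    push_cast
    ring_nf
  simp_rw [h1]
  rw [integral_comp_abs (f := fun y : ℝ =>
      (Real.sqrt (2 * Real.pi))⁻¹ * (y ^ q * Real.exp (-(1 / 2) * y ^ (2 : ℝ)))),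
    integral_const_mul,
    integral_rpow_mul_exp_neg_mul_rpow (by norm_num) (by linarith) (by norm_num),
    Real.sqrt_mul (by norm_num), one_div, Real.inv_rpow (by norm_num),
    ← Real.rpow_neg (by norm_num),
    show -(-(q + 1) / 2) = q / 2 + 1 / 2 by ring, Real.rpow_add (by norm_num), ← Real.sqrt_eq_rpow]
  have : Real.sqrt 2 ≠ 0 := by positivity
  have : Real.sqrt Real.pi ≠ 0 := by positivity
  field_simp

theorem lintegral_abs_rpow_isonormal (a : SeqSpace) {q : ℝ} (hq : 0 ≤ q) :
    ∫⁻ ω, ENNReal.ofReal (|isonormal a ω| ^ q) ∂whiteNoise =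
      ENNReal.ofReal (‖a‖ ^ q * (2 ^ (q / 2) * Real.Gamma ((q + 1) / 2) / Real.sqrt Real.pi)) := by
  have h1 : whiteNoise.map (isonormal a) = (gaussianReal 0 1).map (‖a‖ * ·) := by
    rw [map_isonormal, gaussianReal_map_const_mul]
    congr 1
    · simp
    · ext; simp
  rw [← lintegral_map (f := fun x => ENNReal.ofReal (|x| ^ q)) (by fun_prop)
    (measurable_isonormal a), h1, lintegral_map (by fun_prop) (by fun_prop),
    ENNReal.ofReal_mul (by positivity), ← lintegral_abs_rpow_gaussianReal hq,
    ← lintegral_const_mul _ (by fun_prop)]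
  refine lintegral_congr fun x => ?_
  rw [← ENNReal.ofReal_mul (by positivity), abs_mul, abs_norm, Real.mul_rpow (by positivity)
    (by positivity)]

theorem lintegral_tilt_sq (b : SeqSpace) :
    ∫⁻ ω, ENNReal.ofReal (tilt b ω ^ 2) ∂whiteNoise = ENNReal.ofReal (Real.exp (‖b‖ ^ 2)) := by
  have h : ∀ ω, tilt b ω ^ 2 = Real.exp (-2 * isonormal b ω) * Real.exp (-‖b‖ ^ 2) := by
    intro ω
    rw [tilt, ← Real.exp_nat_mul, ← Real.exp_add]; congr 1; push_cast; ring
  simp_rw [h]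
  rw [← ofReal_integral_eq_lintegral_ofReal ((integrable_exp_isonormal b (-2)).mul_const _)
    (Eventually.of_forall fun x => by positivity), integral_mul_const, integral_exp_isonormal,
    ← Real.exp_add]
  ring_nf

/-- Absolute moments under the tilt, by the Cauchy–Schwarz inequality against its density. -/
theorem lintegral_abs_rpow_isonormal_tiltedNoise_le (a b : SeqSpace) {p : ℝ} (hp : 0 ≤ p) :
    ∫⁻ ω, ENNReal.ofReal (|isonormal a ω| ^ p) ∂tiltedNoise b ≤
      ENNReal.ofReal (‖a‖ ^ p * Real.sqrt (2 ^ p * Real.Gamma (p + 1 / 2) / Real.sqrt Real.pi) *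
        Real.exp (‖b‖ ^ 2 / 2)) := by
  have hm : Measurable fun ω => ENNReal.ofReal (|isonormal a ω| ^ p) := by
    have := measurable_isonormal a
    fun_prop
  have hm2 : Measurable fun ω => ENNReal.ofReal (|isonormal a ω| ^ (2 * p)) := by
    have := measurable_isonormal a
    fun_prop
  rw [lintegral_tiltedNoise _ _ hm]
  have h := ENNReal.lintegral_mul_norm_pow_le (μ := whiteNoise)
    (f := fun ω => ENNReal.ofReal (|isonormal a ω| ^ (2 * p)))
    (g := fun ω => ENNReal.ofReal (tilt b ω ^ 2)) (p := 1 / 2) (q := 1 / 2)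
    hm2.aemeasurable ((measurable_tilt b).pow_const 2).ennreal_ofReal.aemeasurable
    (by norm_num) (by norm_num) (by norm_num)
  rw [lintegral_abs_rpow_isonormal a (by positivity), lintegral_tilt_sq,
    ENNReal.ofReal_rpow_of_nonneg (by positivity) (by norm_num),
    ENNReal.ofReal_rpow_of_nonneg (by positivity) (by norm_num),
    ← ENNReal.ofReal_mul (by positivity)] at h
  refine (le_of_eq (lintegral_congr fun ω => ?_)).trans (h.trans (le_of_eq ?_))
  · rw [ENNReal.ofReal_rpow_of_nonneg (by positivity) (by norm_num),
      ENNReal.ofReal_rpow_of_nonneg (by positivity) (by norm_num), ← Real.rpow_mul (abs_nonneg _),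
      ← Real.sqrt_eq_rpow (tilt b ω ^ 2), Real.sqrt_sq (tilt_nonneg b ω)]
    congr 3
    ring
  · rw [Real.mul_rpow (by positivity) (by positivity), ← Real.rpow_mul (norm_nonneg _),
      ← Real.exp_mul, ← Real.sqrt_eq_rpow, show 2 * p * (1 / 2) = p by ring,
      show 2 * p / 2 = p by ring, show (2 * p + 1) / 2 = p + 1 / 2 by ring,
      show ‖b‖ ^ 2 * (1 / 2) = ‖b‖ ^ 2 / 2 by ring]

/-- Hölder's inequality for a product of `n` values of the tilted process with equal variances: the
product is no larger, in the mean, than a single value to the power `n α`. -/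
theorem lintegral_prod_abs_rpow_isonormal_le {n : ℕ} (hn : 1 ≤ n) (b : SeqSpace)
    (v : Fin n → SeqSpace) {s : ℝ} (hs : ∀ a, ‖v a‖ = s) {α : ℝ} (hα : 0 ≤ α) :
    ∫⁻ ω, ENNReal.ofReal (∏ a, |isonormal (v a) ω| ^ α) ∂tiltedNoise b ≤
      ENNReal.ofReal (s ^ (n * α) *
        Real.sqrt (2 ^ (n * α) * Real.Gamma (n * α + 1 / 2) / Real.sqrt Real.pi) *
        Real.exp (‖b‖ ^ 2 / 2)) := by
  have hn0 : (n : ℝ) ≠ 0 := by positivity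
  have h := ENNReal.lintegral_prod_norm_pow_le (μ := tiltedNoise b) Finset.univ
    (f := fun a ω => ENNReal.ofReal (|isonormal (v a) ω| ^ (n * α)))
    (fun a _ => by
      have := measurable_isonormal (v a)
      fun_prop) (p := fun _ => (n : ℝ)⁻¹)
    (by simp [hn0]) (fun _ _ => by positivity)
  refine (le_of_eq (lintegral_congr fun ω => ?_)).trans (h.trans ?_)
  · rw [ENNReal.ofReal_prod_of_nonneg (fun _ _ => by positivity)]
    refine Finset.prod_congr rfl fun a _ => ?_
    rw [ENNReal.ofReal_rpow_of_nonneg (by positivity) (by positivity),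
      ← Real.rpow_mul (abs_nonneg _)]
    congr 2
    field_simp
  · have hK := fun a => lintegral_abs_rpow_isonormal_tiltedNoise_le (v a) b
      (p := n * α) (by positivity)
    simp only [hs] at hK
    refine (Finset.prod_le_prod' fun a _ => ENNReal.rpow_le_rpow (hK a) (by positivity)).trans
      (le_of_eq ?_)
    rw [Finset.prod_const, Finset.card_univ, Fintype.card_fin, ← ENNReal.rpow_natCast,
      ← ENNReal.rpow_mul, inv_mul_cancel₀ hn0, ENNReal.rpow_one]

end Tilt

/-! ### Feature maps of the propagator -/

section Mercer

/-- The standing spectral hypothesis: the orthonormal basis `e` diagonalises the propagator with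
positive summable eigenvalues `lam`. -/
structure Diagonalizes {d : ℕ} {L : ℝ} [Fact (0 < L)] (G : C(Box d L, ℝ))
    (e : HilbertBasis ℕ ℝ (FieldSpace d L)) (lam : ℕ → ℝ) : Prop where
  pos : ∀ k, 0 < lam k
  summable : Summable lam
  eigen : ∀ k, propagatorOp G (e k) = lam k • e k

variable {d : ℕ} {L : ℝ} [Fact (0 < L)] {G : C(Box d L, ℝ)}
  {e : HilbertBasis ℕ ℝ (FieldSpace d L)} {lam : ℕ → ℝ}

theorem propagatorOp_apply (G : C(Box d L, ℝ)) (j : FieldSpace d L) :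
    propagatorOp G j = ContinuousMap.toLp 2 volume ℝ (classicalField G j) := rfl

theorem inner_propagatorOp (G : C(Box d L, ℝ)) (h j : FieldSpace d L) :
    inner ℝ h (propagatorOp G j) = ∫ x, h x * classicalField G j x := by
  rw [L2.inner_def, propagatorOp_apply]
  refine integral_congr_ae ?_
  filter_upwards [ContinuousMap.coeFn_toLp (p := 2) (𝕜 := ℝ) (volume : Measure (Box d L))
    (classicalField G j)] with y hy
  rw [hy]
  simp [mul_comm]

/-- The kernel section `y ↦ G (x - y)` as a field. -/
def kernelField (G : C(Box d L, ℝ)) (x : Box d L) : FieldSpace d L :=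
  ContinuousMap.toLp 2 volume ℝ (G.comp ⟨fun y => x - y, by fun_prop⟩)

theorem inner_kernelField (G : C(Box d L, ℝ)) (x : Box d L) (j : FieldSpace d L) :
    inner ℝ (kernelField G x) j = classicalField G j x :=
  (classicalField_apply_eq_inner G j x).symm

namespace Diagonalizes

variable (h : Diagonalizes G e lam)
include h

theorem toLp_classicalField (k : ℕ) :
    ContinuousMap.toLp 2 volume ℝ (classicalField G (e k)) = lam k • e k :=
  h.eigen k

/-- The quadratic form of the propagator in the eigenbasis. -/
theorem hasSum_inner_propagatorOp (j : FieldSpace d L) :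
    HasSum (fun k => lam k * inner ℝ (e k) j ^ 2) (inner ℝ j (propagatorOp G j)) := by
  have h1 := ((e.hasSum_repr j).mapL (propagatorOp G)).mapL (innerSL ℝ j)
  convert! h1 using 1
  ext k
  rw [map_smul, h.eigen, innerSL_apply_apply, inner_smul_right, inner_smul_right,
    e.repr_apply_apply, real_inner_comm]
  ring

theorem eigenvalue_le_norm (k : ℕ) : lam k ≤ ‖propagatorOp G‖ := by
  have h1 := (propagatorOp G).le_opNorm (e k)
  rw [h.eigen, norm_smul, e.orthonormal.1 k, mul_one, mul_one, Real.norm_eq_abs,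
    abs_of_pos (h.pos k)] at h1
  exact h1

theorem setIntegral_eigen (k : ℕ) {U : Set (Box d L)} (hU : MeasurableSet U) :
    ∫ x in U, classicalField G (e k) x =
      lam k * inner ℝ (e k) (indicatorConstLp 2 hU (measure_ne_top volume U) (1 : ℝ)) := by
  have h1 := L2.inner_indicatorConstLp_one (𝕜 := ℝ) hU (measure_ne_top volume U)
    (ContinuousMap.toLp 2 volume ℝ (classicalField G (e k)))
  rw [h.toLp_classicalField, inner_smul_right, real_inner_comm] at h1
  rw [h1]
  refine integral_congr_ae (ae_restrict_of_ae ?_)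
  rw [← h.toLp_classicalField]
  exact (ContinuousMap.coeFn_toLp (volume : Measure (Box d L)) _).symm

/-- Mercer's inequality: subtracting finitely many eigencomponents from the kernel leaves a positive
operator, so the diagonal of the remaining continuous kernel is nonnegative. -/
theorem sum_sq_classicalField_le (x : Box d L) (s : Finset ℕ) :
    ∑ k ∈ s, classicalField G (e k) x ^ 2 / lam k ≤ G 0 := by
  by_contra! hcon
  set D : Box d L × Box d L → ℝ := fun p => G (p.1 - p.2) -
    ∑ k ∈ s, (lam k)⁻¹ * (classicalField G (e k) p.1 * classicalField G (e k) p.2) with hD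
  have hDc : Continuous D := by fun_prop
  have hDx : D (x, x) < 0 := by
    have h1 : ∑ k ∈ s, (lam k)⁻¹ * (classicalField G (e k) x * classicalField G (e k) x) =
        ∑ k ∈ s, classicalField G (e k) x ^ 2 / lam k :=
      Finset.sum_congr rfl fun k _ => by ring
    simp only [hD, sub_self, sub_neg]
    rwa [h1]
  obtain ⟨U, hUo, hxU, hU⟩ : ∃ U : Set (Box d L), IsOpen U ∧ x ∈ U ∧
      ∀ y ∈ U, ∀ z ∈ U, D (y, z) < D (x, x) / 2 := by
    have h1 : D ⁻¹' Set.Iio (D (x, x) / 2) ∈ 𝓝 (x, x) :=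
      hDc.continuousAt.preimage_mem_nhds (Iio_mem_nhds (by linarith))
    rw [nhds_prod_eq, mem_prod_same_iff] at h1
    obtain ⟨V, hV, hVD⟩ := h1
    obtain ⟨U, hUV, hUo, hxU⟩ := mem_nhds_iff.1 hV
    exact ⟨U, hUo, hxU, fun y hy z hz => hVD ⟨hUV hy, hUV hz⟩⟩
  have hvol : 0 < volume.real U :=
    ENNReal.toReal_pos (hUo.measure_pos volume ⟨x, hxU⟩).ne' (measure_ne_top _ _)
  have hUm := hUo.measurableSet
  set χ : FieldSpace d L := indicatorConstLp 2 hUm (measure_ne_top volume U) (1 : ℝ) with hχ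
  have hci : ∀ f : C(Box d L, ℝ), IntegrableOn f U := fun f =>
    (f.continuous.integrable_of_hasCompactSupport
      (HasCompactSupport.of_compactSpace _)).integrableOn
  -- the double integral of `D` over `U × U` is negative
  have hin : ∀ y, ∫ z in U, D (y, z) = (∫ z in U, G (y - z)) -
      ∑ k ∈ s, (lam k)⁻¹ * (classicalField G (e k) y * ∫ z in U, classicalField G (e k) z) := by
    intro y
    simp only [hD]
    have hG : IntegrableOn (fun z => G (y - z)) U := hci (G.comp ⟨fun z => y - z, by fun_prop⟩)
    rw [integral_sub hG (integrable_finsetSum _ fun k _ =>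
      (((hci (classicalField G (e k))).const_mul _).const_mul _)), integral_finsetSum _ fun k _ =>
      (((hci (classicalField G (e k))).const_mul _).const_mul _)]
    simp_rw [integral_const_mul]
  have hcl : ∀ y, classicalField G χ y = ∫ z in U, G (y - z) := by
    intro y
    rw [← inner_kernelField, real_inner_comm, hχ, L2.inner_indicatorConstLp_one]
    exact integral_congr_ae (ae_restrict_of_ae (ContinuousMap.coeFn_toLp
      (volume : Measure (Box d L)) _))
  have hout : ∫ y in U, ∫ z in U, D (y, z) = inner ℝ χ (propagatorOp G χ) -
      ∑ k ∈ s, lam k * inner ℝ (e k) χ ^ 2 := by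
    simp_rw [hin, ← hcl]
    rw [integral_sub (hci _) (integrable_finsetSum _ fun k _ =>
      (((hci (classicalField G (e k))).mul_const _).const_mul _)), integral_finsetSum _ fun k _ =>
      (((hci (classicalField G (e k))).mul_const _).const_mul _)]
    congr 1
    · rw [hχ, L2.inner_indicatorConstLp_one, propagatorOp_apply]
      exact (integral_congr_ae (ae_restrict_of_ae (ContinuousMap.coeFn_toLp
        (volume : Measure (Box d L)) _))).symm
    · refine Finset.sum_congr rfl fun k _ => ?_
      rw [integral_const_mul, integral_mul_const, h.setIntegral_eigen k hUm]
      have := (h.pos k).ne'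
      field_simp
      rfl
  have hpos : 0 ≤ ∫ y in U, ∫ z in U, D (y, z) := by
    rw [hout, sub_nonneg]
    exact sum_le_hasSum s (fun k _ => mul_nonneg (h.pos k).le (sq_nonneg _))
      (h.hasSum_inner_propagatorOp χ)
  have hneg : ∫ y in U, ∫ z in U, D (y, z) ≤ ∫ y in U, ∫ z in U, D (x, x) / 2 := by
    refine setIntegral_mono_on ?_ (integrable_const _).integrableOn hUm fun y hy => ?_
    · simp_rw [hin, ← hcl]
      exact (hci _).sub (integrable_finsetSum _ fun k _ =>
        (((hci (classicalField G (e k))).mul_const _).const_mul _))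
    · exact setIntegral_mono_on (hci ⟨fun z => D (y, z), by fun_prop⟩)
        (integrable_const _).integrableOn hUm fun z hz => (hU y hy z hz).le
  simp only [setIntegral_const, smul_eq_mul] at hneg
  have : volume.real U * (volume.real U * (D (x, x) / 2)) < 0 :=
    mul_neg_of_pos_of_neg hvol (mul_neg_of_pos_of_neg hvol (by linarith))
  linarith

theorem memℓp_fieldVec (x : Box d L) :
    Memℓp (fun k => classicalField G (e k) x / Real.sqrt (lam k)) 2 := by
  refine memℓp_gen ?_
  refine summable_of_sum_le (c := G 0) (fun k => by positivity) fun s => ?_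
  convert h.sum_sq_classicalField_le x s using 2 with k
  simp [div_pow, Real.sq_sqrt (h.pos k).le]

theorem memℓp_sourceVec (j : FieldSpace d L) :
    Memℓp (fun k => Real.sqrt (lam k) * inner ℝ (e k) j) 2 := by
  refine memℓp_gen ?_
  convert (h.hasSum_inner_propagatorOp j).summable using 2 with k
  simp [mul_pow, Real.sq_sqrt (h.pos k).le]

end Diagonalizes

/-- The coefficients of the free field at the point `x` with respect to the white noise: the field
is `∑ₖ √(lam k) ωₖ eₖ`, and `classicalField G (e k) / lam k` is the continuous representative of
`e k`. -/
def fieldVec (h : Diagonalizes G e lam) (x : Box d L) : SeqSpace :=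
  ⟨fun k => classicalField G (e k) x / Real.sqrt (lam k), h.memℓp_fieldVec x⟩

/-- The coefficients, with respect to the white noise, of the pairing of the free field with the
source `j`. It is the superposition `∫ j(x) fieldVec(x) dx` of the field vectors. -/
def sourceVec (h : Diagonalizes G e lam) (j : FieldSpace d L) : SeqSpace :=
  ⟨fun k => Real.sqrt (lam k) * inner ℝ (e k) j, h.memℓp_sourceVec j⟩

theorem fieldVec_apply (h : Diagonalizes G e lam) (x : Box d L) (k : ℕ) :
    fieldVec h x k = classicalField G (e k) x / Real.sqrt (lam k) := rfl

theorem sourceVec_apply (h : Diagonalizes G e lam) (j : FieldSpace d L) (k : ℕ) :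
    sourceVec h j k = Real.sqrt (lam k) * inner ℝ (e k) j := rfl

namespace Diagonalizes

variable (h : Diagonalizes G e lam)
include h

theorem norm_sourceVec_sq (j : FieldSpace d L) :
    ‖sourceVec h j‖ ^ 2 = inner ℝ j (propagatorOp G j) := by
  refine (hasSum_sq_norm_sq (sourceVec h j)).unique ?_
  convert h.hasSum_inner_propagatorOp j using 2 with k
  rw [sourceVec_apply, mul_pow, Real.sq_sqrt (h.pos k).le]

theorem norm_sourceVec_sq_le (j : FieldSpace d L) :
    ‖sourceVec h j‖ ^ 2 ≤ ‖propagatorOp G‖ * ‖j‖ ^ 2 := by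
  rw [h.norm_sourceVec_sq]
  refine (real_inner_le_norm _ _).trans ?_
  have := (propagatorOp G).le_opNorm j
  nlinarith [norm_nonneg j]

/-- The covariance of the field at `x` with its pairing with `j` is the classical field. -/
theorem inner_fieldVec_sourceVec (x : Box d L) (j : FieldSpace d L) :
    inner ℝ (fieldVec h x) (sourceVec h j) = classicalField G j x := by
  refine (lp.hasSum_inner (𝕜 := ℝ) (fieldVec h x) (sourceVec h j)).unique ?_
  have h1 := e.hasSum_inner_mul_inner (kernelField G x) j
  rw [inner_kernelField] at h1
  convert h1 using 2 with k
  rw [inner_kernelField, fieldVec_apply, sourceVec_apply]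
  have : Real.sqrt (lam k) ≠ 0 := (Real.sqrt_pos.2 (h.pos k)).ne'
  simp only [RCLike.inner_apply, conj_trivial]
  field_simp

/-- For square-summable coefficients the eigenfunction series converges uniformly. -/
theorem exists_hasSum_continuousMap (a : SeqSpace) : ∃ S : C(Box d L, ℝ),
    HasSum (fun k => (a k / Real.sqrt (lam k)) • classicalField G (e k)) S ∧
      ∀ y, S y = inner ℝ a (fieldVec h y) := by
  have hG : 0 ≤ G 0 := by simpa using h.sum_sq_classicalField_le 0 ∅
  have hs : Summable fun k => (a k / Real.sqrt (lam k)) • classicalField G (e k) := by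
    -- Cauchy–Schwarz and Mercer's inequality bound the tails uniformly in the point
    rw [summable_iff_vanishing_norm]
    intro ε hε
    obtain ⟨s, hs⟩ := summable_iff_vanishing_norm.1 (hasSum_sq_norm_sq a).summable
      (ε ^ 2 / (G 0 + 1)) (by positivity)
    refine ⟨s, fun t ht => ?_⟩
    have h1 := hs t ht
    rw [Real.norm_of_nonneg (Finset.sum_nonneg fun _ _ => sq_nonneg _),
      lt_div_iff₀ (by positivity)] at h1
    rw [ContinuousMap.norm_lt_iff _ hε]
    intro y
    rw [Real.norm_eq_abs]
    refine abs_lt_of_sq_lt_sq ?_ hε.le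
    have h2 := Finset.sum_mul_sq_le_sq_mul_sq t a
      (fun k => classicalField G (e k) y / Real.sqrt (lam k))
    have h3 := h.sum_sq_classicalField_le y t
    have h4 : ∑ k ∈ t, (classicalField G (e k) y / Real.sqrt (lam k)) ^ 2 =
        ∑ k ∈ t, classicalField G (e k) y ^ 2 / lam k :=
      Finset.sum_congr rfl fun k _ => by rw [div_pow, Real.sq_sqrt (h.pos k).le]
    rw [h4] at h2
    have h5 : (∑ k ∈ t, (a k / Real.sqrt (lam k)) • classicalField G (e k)) y =
        ∑ k ∈ t, a k * (classicalField G (e k) y / Real.sqrt (lam k)) := by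
      rw [ContinuousMap.sum_apply]
      refine Finset.sum_congr rfl fun k _ => ?_
      rw [ContinuousMap.smul_apply, smul_eq_mul]; ring
    rw [h5]
    have h6 : 0 ≤ ∑ k ∈ t, a k ^ 2 := Finset.sum_nonneg fun _ _ => sq_nonneg _
    nlinarith
  refine ⟨_, hs.hasSum, fun y => ?_⟩
  have h1 := hs.hasSum.mapL (ContinuousMap.evalCLM ℝ y)
  refine h1.unique ?_
  convert! lp.hasSum_inner (𝕜 := ℝ) a (fieldVec h y) using 2 with k
  rw [fieldVec_apply]
  simp
  ring

/-- The uniform limit of the eigenfunction series is also its limit in `L²`, where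
`classicalField G (e k)` is `lam k • e k`. -/
theorem hasSum_toLp_of_hasSum {a : ℕ → ℝ} {S : C(Box d L, ℝ)}
    (hS : HasSum (fun k => (a k / Real.sqrt (lam k)) • classicalField G (e k)) S) :
    HasSum (fun k => (a k * Real.sqrt (lam k)) • e k)
      (ContinuousMap.toLp 2 volume ℝ S : FieldSpace d L) := by
  convert! hS.mapL (ContinuousMap.toLp 2 volume ℝ : C(Box d L, ℝ) →L[ℝ] FieldSpace d L) using 2
    with k
  rw [map_smul, h.toLp_classicalField, smul_smul]
  congr 1
  have h0 : Real.sqrt (lam k) ≠ 0 := (Real.sqrt_pos.2 (h.pos k)).ne'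
  field_simp
  rw [Real.sq_sqrt (h.pos k).le]

/-- Mercer's theorem: the eigenfunction expansion of the kernel holds at every pair of points. -/
theorem inner_fieldVec (x y : Box d L) : inner ℝ (fieldVec h x) (fieldVec h y) = G (x - y) := by
  obtain ⟨S, hS, hSy⟩ := h.exists_hasSum_continuousMap (fieldVec h x)
  have h1 : (ContinuousMap.toLp 2 volume ℝ S : FieldSpace d L) = kernelField G x := by
    refine (h.hasSum_toLp_of_hasSum hS).unique ?_
    convert! e.hasSum_repr (kernelField G x) using 2 with k
    rw [e.repr_apply_apply, real_inner_comm, inner_kernelField, fieldVec_apply]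
    have h0 : Real.sqrt (lam k) ≠ 0 := (Real.sqrt_pos.2 (h.pos k)).ne'
    field_simp
  have h2 := (ContinuousMap.toLp_inj (p := 2) (𝕜 := ℝ) (volume : Measure (Box d L))).1 h1
  rw [← hSy, h2]
  rfl

theorem norm_fieldVec_sq (x : Box d L) : ‖fieldVec h x‖ ^ 2 = G 0 := by
  rw [← real_inner_self_eq_norm_sq, h.inner_fieldVec, sub_self]

theorem norm_fieldVec (x : Box d L) : ‖fieldVec h x‖ = Real.sqrt (G 0) := by
  rw [← h.norm_fieldVec_sq x, Real.sqrt_sq (norm_nonneg _)]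

theorem continuous_fieldVec : Continuous (fieldVec h) := by
  rw [continuous_iff_continuousAt]
  intro x
  rw [ContinuousAt, tendsto_iff_norm_sub_tendsto_zero]
  have h1 : ∀ y, ‖fieldVec h y - fieldVec h x‖ = Real.sqrt (2 * G 0 - 2 * G (y - x)) := by
    intro y
    rw [← Real.sqrt_sq (norm_nonneg (fieldVec h y - fieldVec h x)), norm_sub_sq_real,
      h.norm_fieldVec_sq, h.norm_fieldVec_sq, h.inner_fieldVec]
    congr 1; ring
  simp_rw [h1]
  have : Continuous fun y => Real.sqrt (2 * G 0 - 2 * G (y - x)) := by fun_prop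
  simpa using this.tendsto x

theorem covMatrix_eq_gram {n : ℕ} (x : Fin n → Box d L) :
    covMatrix G x = Matrix.gram ℝ fun a => fieldVec h (x a) := by
  ext a b
  simp [covMatrix, Matrix.gram_apply, h.inner_fieldVec]

end Diagonalizes

end Mercer

/-! ### Almost everywhere positive definiteness of the covariance matrix -/

section PosDef

theorem continuous_covMatrix {d : ℕ} {L : ℝ} (G : C(Box d L, ℝ)) (n : ℕ) :
    Continuous fun x : Fin n → Box d L => covMatrix G x :=
  continuous_matrix fun a b => by simp only [covMatrix, Matrix.of_apply]; fun_prop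

variable {d : ℕ} {L : ℝ} [Fact (0 < L)] {G : C(Box d L, ℝ)}
  {e : HilbertBasis ℕ ℝ (FieldSpace d L)} {lam : ℕ → ℝ}

instance nullSingletonClass_addCircle : NullSingletonClass (volume : Measure (AddCircle L)) where
  measure_singleton x := by
    have h := AddCircle.volume_closedBall (T := L) (x := x) 0
    rw [Metric.closedBall_zero] at h
    rw [h]
    simp [(Fact.out : 0 < L).le]

/-- A set of positive measure contains arbitrarily many disjoint measurable sets of positive
measure. -/
theorem exists_disjoint_subsets_of_measure_ne_zero {X : Type*} [TopologicalSpace X] [T2Space X]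
    [SecondCountableTopology X] [MeasurableSpace X] [OpensMeasurableSpace X] {μ : Measure X}
    [NullSingletonClass μ] {E : Set X} (hE : MeasurableSet E) (hμ : μ E ≠ 0) (n : ℕ) :
    ∃ (t : Finset X) (A : X → Set X), t.card = n ∧ (∀ x, MeasurableSet (A x)) ∧
      (∀ x, A x ⊆ E) ∧ (∀ x ∈ t, μ (A x) ≠ 0) ∧ (t : Set X).PairwiseDisjoint A := by
  -- the points of `E` all of whose neighbourhoods in `E` have positive measure carry `E` up to a
  -- null set, so there are infinitely many of them
  set Y : Set X := {x ∈ E | ∀ t ∈ 𝓝[E] x, 0 < μ t} with hY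
  have hinf : Y.Infinite := by
    intro hfin
    have h1 : μ (E \ Y) ≠ 0 := by rwa [measure_sdiff_null (hfin.measure_zero μ)]
    obtain ⟨x, hx, hx'⟩ := exists_mem_forall_mem_nhdsWithin_pos_measure h1
    exact hx.2 ⟨hx.1, fun t ht => hx' t (nhdsWithin_mono x Set.sdiff_subset ht)⟩
  obtain ⟨t, htY, htn⟩ := hinf.exists_subset_card_eq n
  obtain ⟨U, hU, hdisj⟩ := t.finite_toSet.t2_separation
  refine ⟨t, fun x => E ∩ U x, htn, fun x => hE.inter (hU x).2.measurableSet,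
    fun x => Set.inter_subset_left, fun x hx => ?_, ?_⟩
  · exact ((htY hx).2 _ (inter_mem self_mem_nhdsWithin
      (mem_nhdsWithin_of_mem_nhds ((hU x).2.mem_nhds (hU x).1)))).ne'
  · exact hdisj.mono fun x => Set.inter_subset_right

namespace Diagonalizes

variable (h : Diagonalizes G e lam)
include h

/-- A vector orthogonal to the field vectors at the points of the support of `j` is orthogonal to
the source vector of `j`, which is their superposition. -/
theorem inner_sourceVec_eq_zero {j : FieldSpace d L} {a : SeqSpace}
    (hj : ∀ᵐ x, j x = 0 ∨ inner ℝ a (fieldVec h x) = 0) : inner ℝ a (sourceVec h j) = 0 := by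
  obtain ⟨S, hS, hSy⟩ := h.exists_hasSum_continuousMap a
  have h1 := (h.hasSum_toLp_of_hasSum hS).mapL (innerSL ℝ j)
  have h2 : inner ℝ a (sourceVec h j) = inner ℝ j (ContinuousMap.toLp 2 volume ℝ S) := by
    refine (lp.hasSum_inner (𝕜 := ℝ) a (sourceVec h j)).unique ?_
    convert! h1 using 2 with k
    rw [sourceVec_apply, innerSL_apply_apply, inner_smul_right, real_inner_comm j]
    simp
    ring
  rw [h2, L2.inner_def]
  refine integral_eq_zero_of_ae ?_
  filter_upwards [hj, ContinuousMap.coeFn_toLp (p := 2) (𝕜 := ℝ) (volume : Measure (Box d L)) S]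
    with x hx hS'
  rw [hS', hSy]
  rcases hx with hx | hx <;> simp [hx]

/-- `sourceVec` is linear, and injective because all eigenvalues are positive. -/
theorem exists_linearMap_sourceVec : ∃ T : FieldSpace d L →ₗ[ℝ] SeqSpace,
    (∀ j, T j = sourceVec h j) ∧ Function.Injective T := by
  refine ⟨{ toFun := sourceVec h, map_add' := fun i j => ?_, map_smul' := fun c j => ?_ },
    fun j => rfl, ?_⟩
  · ext k
    simp only [sourceVec_apply, lp.coeFn_add, Pi.add_apply, inner_add_right]
    ring
  · ext k
    simp only [sourceVec_apply, lp.coeFn_smul, Pi.smul_apply, inner_smul_right, RingHom.id_apply,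
      smul_eq_mul]
    ring
  · rw [← LinearMap.ker_eq_bot, LinearMap.ker_eq_bot']
    intro j hj
    have h1 : ∀ k, e.repr j k = 0 := by
      intro k
      have h2 : sourceVec h j k = 0 := by
        have : sourceVec h j = 0 := hj
        rw [this]; rfl
      rw [sourceVec_apply] at h2
      rw [e.repr_apply_apply]
      exact (mul_eq_zero.1 h2).resolve_left (Real.sqrt_pos.2 (h.pos k)).ne'
    have h3 : e.repr j = 0 := by ext k; exact h1 k
    simpa using h3

/-- Only a null set of points has its field vector in a given finite-dimensional subspace: the
source vectors of fields supported on that set would lie in the subspace, but they form an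
infinite-dimensional space. -/
theorem volume_fieldVec_mem_eq_zero (hd : 1 ≤ d) (S : Submodule ℝ SeqSpace)
    [FiniteDimensional ℝ S] : volume {x | fieldVec h x ∈ S} = 0 := by
  by_contra hne
  have : Nonempty (Fin d) := ⟨⟨0, hd⟩⟩
  have hmeas : MeasurableSet {x | fieldVec h x ∈ S} :=
    (S.closed_of_finiteDimensional.preimage h.continuous_fieldVec).measurableSet
  have hna : NullSingletonClass (volume : Measure (Box d L)) :=
    Measure.pi_nullSingletonClass'
  obtain ⟨t, A, htn, hA, hAE, hpos, hdisj⟩ := exists_disjoint_subsets_of_measure_ne_zero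
    (μ := (volume : Measure (Box d L))) hmeas hne (Module.finrank ℝ S + 1)
  obtain ⟨T, hT, hTinj⟩ := h.exists_linearMap_sourceVec
  let χ : t → FieldSpace d L := fun x =>
    indicatorConstLp 2 (hA x) (measure_ne_top volume (A x)) (1 : ℝ)
  have hχ : LinearIndependent ℝ χ := by
    refine linearIndependent_of_ne_zero_of_inner_eq_zero (𝕜 := ℝ) (fun x hx => ?_)
      fun x y hxy => ?_
    · have h1 := L2.inner_indicatorConstLp_one (𝕜 := ℝ) (hA x) (measure_ne_top volume (A x)) (χ x)
      rw [hx, inner_zero_right] at h1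
      rw [← hx, integral_congr_ae (ae_restrict_of_ae
        (indicatorConstLp_coeFn (p := 2) (hs := hA x) (hμs := measure_ne_top volume (A x)))),
        setIntegral_indicator (hA x), Set.inter_self, setIntegral_const] at h1
      simp only [smul_eq_mul, mul_one] at h1
      exact (ENNReal.toReal_pos (hpos x x.2) (measure_ne_top _ _)).ne h1
    · have h1 := L2.inner_indicatorConstLp_one (𝕜 := ℝ) (hA x) (measure_ne_top volume (A x)) (χ y)
      refine h1.trans ?_
      rw [integral_congr_ae (ae_restrict_of_ae
        (indicatorConstLp_coeFn (p := 2) (hs := hA y) (hμs := measure_ne_top volume (A y)))),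
        setIntegral_indicator (hA y), (hdisj x.2 y.2 (fun hh => hxy (Subtype.ext hh))).inter_eq]
      simp
  -- a finite-dimensional subspace is its own double orthogonal complement
  have hmem : ∀ x : t, T (χ x) ∈ S := by
    intro x
    rw [← S.orthogonal_orthogonal, Submodule.mem_orthogonal]
    intro a ha
    rw [hT]
    refine h.inner_sourceVec_eq_zero ?_
    filter_upwards [indicatorConstLp_coeFn (p := 2) (hs := hA x)
      (hμs := measure_ne_top volume (A x)) (c := (1 : ℝ))] with y hy
    by_cases hyA : y ∈ A x
    · exact Or.inr (by
        rw [real_inner_comm]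
        exact (Submodule.mem_orthogonal S a).1 ha _ (hAE x hyA))
    · exact Or.inl (by rw [hy, Set.indicator_of_notMem hyA])
  have hlin : LinearIndependent ℝ fun x : t => (⟨T (χ x), hmem x⟩ : S) := by
    refine LinearIndependent.of_comp S.subtype ?_
    exact hχ.map' T (LinearMap.ker_eq_bot.2 hTinj)
  have := hlin.fintype_card_le_finrank
  simp [htn] at this

theorem det_covMatrix_ne_zero_iff {n : ℕ} (x : Fin n → Box d L) :
    (covMatrix G x).det ≠ 0 ↔ LinearIndependent ℝ fun a => fieldVec h (x a) := by
  rw [h.covMatrix_eq_gram, Matrix.det_gram_ne_zero_iff_linearIndependent]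

/-- Independence of the field vectors at generic points, by adding one point at a time: the new
point has to avoid the null set of points whose field vector lies in the span of the others. -/
theorem ae_linearIndependent_fieldVec (hd : 1 ≤ d) (n : ℕ) :
    ∀ᵐ x : Fin n → Box d L, LinearIndependent ℝ fun a => fieldVec h (x a) := by
  induction n with
  | zero => exact Eventually.of_forall fun x => linearIndependent_empty_type
  | succ n ih =>
    have hmeas : MeasurableSet {p : Box d L × (Fin n → Box d L) | LinearIndependent ℝ fun a =>
        fieldVec h ((Fin.cons p.1 p.2 : Fin (n + 1) → Box d L) a)} := by
      simp_rw [← h.det_covMatrix_ne_zero_iff]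
      have : Continuous fun p : Box d L × (Fin n → Box d L) =>
          (covMatrix G (Fin.cons p.1 p.2 : Fin (n + 1) → Box d L)).det :=
        (continuous_covMatrix G (n + 1)).matrix_det.comp (by fun_prop)
      exact (isOpen_ne.preimage this).measurableSet
    have hmp := volume_preserving_piFinSuccAbove (fun _ : Fin (n + 1) => Box d L) 0
    have key : ∀ᵐ p : Box d L × (Fin n → Box d L),
        LinearIndependent ℝ fun a => fieldVec h ((Fin.cons p.1 p.2 : Fin (n + 1) → Box d L) a) := by
      refine (Measure.ae_prod_mem_iff_ae_ae_mem hmeas).2 ?_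
      refine (Measure.ae_ae_comm hmeas).2 ?_
      filter_upwards [ih] with x hx
      have : FiniteDimensional ℝ (Submodule.span ℝ (Set.range fun a => fieldVec h (x a))) :=
        FiniteDimensional.span_of_finite ℝ (Set.finite_range _)
      have h0 := h.volume_fieldVec_mem_eq_zero hd
        (Submodule.span ℝ (Set.range fun a => fieldVec h (x a)))
      filter_upwards [measure_eq_zero_iff_ae_notMem.1 h0] with y hy
      have h1 := hx.finCons hy
      convert! h1 using 1
      ext a : 1
      refine Fin.cases ?_ (fun i => ?_) a <;> simp
    have h2 := hmp.quasiMeasurePreserving.ae key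
    filter_upwards [h2] with x hx
    convert! hx using 3 with a
    refine Fin.cases ?_ (fun i => ?_) a <;> simp [MeasurableEquiv.piFinSuccAbove, Fin.tail]

theorem ae_posDef_covMatrix (hd : 1 ≤ d) (n : ℕ) :
    ∀ᵐ x : Fin n → Box d L, (covMatrix G x).PosDef := by
  filter_upwards [h.ae_linearIndependent_fieldVec hd n] with x hx
  rw [h.covMatrix_eq_gram]
  exact Matrix.posDef_gram_of_linearIndependent hx

end Diagonalizes

end PosDef

/-! ### The free field and its pointwise values -/

section FreeField

variable {d : ℕ} {L : ℝ} [Fact (0 < L)] {G : C(Box d L, ℝ)}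
  {e : HilbertBasis ℕ ℝ (FieldSpace d L)} {lam : ℕ → ℝ}

/-- The free field `∑ₖ √(lam k) ωₖ eₖ` as a function of the noise `ω`. Where the series diverges the
value is the default `0`; for summable `lam` this happens only on a null set. -/
def freeField (e : HilbertBasis ℕ ℝ (FieldSpace d L)) (lam : ℕ → ℝ) (ω : ℕ → ℝ) :
    FieldSpace d L :=
  ∑' k, (Real.sqrt (lam k) * ω k) • e k

theorem gaussianMeasure_eq_map : gaussianMeasure e lam = whiteNoise.map (freeField e lam) := rfl

namespace Diagonalizes

variable (h : Diagonalizes G e lam)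
include h

/-- The eigenvalue series is the expectation of this random series. -/
theorem ae_summable_sq : ∀ᵐ ω ∂whiteNoise, Summable fun k => lam k * ω k ^ 2 := by
  have h1 : ∀ k, ∫⁻ ω : ℕ → ℝ, ENNReal.ofReal (lam k * ω k ^ 2) ∂whiteNoise =
      ENNReal.ofReal (lam k) := by
    intro k
    have hint : Integrable (fun ω : ℕ → ℝ => lam k * ω k ^ 2) whiteNoise :=
      (memLp_eval_whiteNoise k).integrable_sq.const_mul _
    rw [← ofReal_integral_eq_lintegral_ofReal hint
      (Eventually.of_forall fun ω => mul_nonneg (h.pos k).le (sq_nonneg _)), integral_const_mul]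
    have := integral_eval_mul_eval_whiteNoise k k
    simp only [← pow_two, if_true] at this
    rw [this, mul_one]
  have hm : ∀ k, Measurable fun ω : ℕ → ℝ => ENNReal.ofReal (lam k * ω k ^ 2) := fun k => by
    fun_prop
  have h2 : ∫⁻ ω : ℕ → ℝ, ∑' k, ENNReal.ofReal (lam k * ω k ^ 2) ∂whiteNoise ≠ ∞ := by
    rw [lintegral_tsum fun k => (hm k).aemeasurable]
    simp_rw [h1]
    rw [← ENNReal.ofReal_tsum_of_nonneg (fun k => (h.pos k).le) h.summable]
    exact ENNReal.ofReal_ne_top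
  filter_upwards [ae_lt_top (Measurable.tsum hm) h2] with ω hω
  have h3 := ENNReal.summable_toReal hω.ne
  refine h3.congr fun k => ?_
  rw [ENNReal.toReal_ofReal (mul_nonneg (h.pos k).le (sq_nonneg _))]

theorem ae_hasSum_freeField : ∀ᵐ ω ∂whiteNoise,
    HasSum (fun k => (Real.sqrt (lam k) * ω k) • e k) (freeField e lam ω) := by
  filter_upwards [h.ae_summable_sq] with ω hω
  have hmem : Memℓp (fun k => Real.sqrt (lam k) * ω k) 2 := by
    refine memℓp_gen ?_
    refine hω.congr fun k => ?_
    simp [mul_pow, Real.sq_sqrt (h.pos k).le]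
  exact (e.hasSum_repr_symm (⟨_, hmem⟩ : SeqSpace)).summable.hasSum

theorem aemeasurable_freeField : AEMeasurable (freeField e lam) whiteNoise := by
  refine aemeasurable_of_tendsto_metrizable_ae (u := atTop)
    (f := fun (N : ℕ) ω => ∑ k ∈ Finset.range N, (Real.sqrt (lam k) * ω k) • e k) (fun N => ?_) ?_
  · have : Continuous fun ω : ℕ → ℝ =>
        ∑ k ∈ Finset.range N, (Real.sqrt (lam k) * ω k) • e k := by fun_prop
    exact this.measurable.aemeasurable
  · filter_upwards [h.ae_hasSum_freeField] with ω hω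
    exact hω.tendsto_sum_nat

/-- The pairing of the free field with a source is the isonormal process. -/
theorem inner_freeField_ae (j : FieldSpace d L) :
    isonormal (sourceVec h j) =ᵐ[whiteNoise] fun ω => inner ℝ j (freeField e lam ω) := by
  refine isonormal_ae_eq_of_tendsto _ strictMono_id ?_
  filter_upwards [h.ae_hasSum_freeField] with ω hω
  have h1 := (hω.mapL (innerSL ℝ j)).tendsto_sum_nat
  refine h1.congr fun N => Finset.sum_congr rfl fun k _ => ?_
  rw [innerSL_apply_apply, inner_smul_right, sourceVec_apply, real_inner_comm]
  ring

theorem ae_hasSum_norm_freeField_sq : ∀ᵐ ω ∂whiteNoise,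
    HasSum (fun k => lam k * ω k ^ 2) (‖freeField e lam ω‖ ^ 2) := by
  filter_upwards [h.ae_hasSum_freeField] with ω hω
  have h1 := hω.mapL (innerSL ℝ (freeField e lam ω))
  rw [innerSL_apply_apply, real_inner_self_eq_norm_sq] at h1
  have h3 : ∀ k, inner ℝ (e k) (freeField e lam ω) = Real.sqrt (lam k) * ω k := by
    intro k
    refine (hω.mapL (innerSL ℝ (e k))).unique ?_
    convert! hasSum_ite_eq k (Real.sqrt (lam k) * ω k) using 1
    ext l
    rw [innerSL_apply_apply, inner_smul_right, orthonormal_iff_ite.1 e.orthonormal]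
    by_cases hkl : l = k
    · subst hkl; simp
    · simp [hkl, Ne.symm hkl]
  convert! h1 using 1
  ext k
  rw [innerSL_apply_apply, inner_smul_right, real_inner_comm, h3]
  nth_rewrite 1 [← Real.sq_sqrt (h.pos k).le]
  ring

/-- The continuous representative of an eigenfunction. -/
theorem eigen_ae (k : ℕ) : e k =ᵐ[volume] fun x => classicalField G (e k) x / lam k := by
  have h1 := ContinuousMap.coeFn_toLp (p := 2) (𝕜 := ℝ) (volume : Measure (Box d L))
    (classicalField G (e k))
  rw [h.toLp_classicalField] at h1
  filter_upwards [h1, Lp.coeFn_smul (lam k) (e k)] with x hx hx'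
  rw [← hx, hx', Pi.smul_apply, smul_eq_mul, mul_div_cancel_left₀ _ (h.pos k).ne']

/-- A jointly measurable version of the free field: for almost every noise it represents the free
field, and for almost every point its value is the isonormal process at the field vector. -/
theorem exists_measurable_field : ∃ Φ : (ℕ → ℝ) → Box d L → ℝ,
    Measurable (Function.uncurry Φ) ∧
    (∀ᵐ ω ∂whiteNoise, freeField e lam ω =ᵐ[volume] Φ ω) ∧
    (∀ᵐ x : Box d L, isonormal (fieldVec h x) =ᵐ[whiteNoise] fun ω => Φ ω x) := by
  set μ : Measure ((ℕ → ℝ) × Box d L) := whiteNoise.prod volume with hμ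
  -- the partial sums converge in `L²` of the product space, and the limit is the version sought
  set ε : ℕ → Box d L → ℝ := fun k x => classicalField G (e k) x / lam k with hε
  have hεc : ∀ k, Continuous (ε k) := fun k => by simp only [hε]; fun_prop
  have hεi : ∀ k l, ∫ x, ε k x * ε l x = if k = l then 1 else 0 := by
    intro k l
    have h1 := orthonormal_iff_ite.1 e.orthonormal l k
    rw [L2.inner_def] at h1
    rw [show (if k = l then (1 : ℝ) else 0) = if l = k then 1 else 0 by simp only [eq_comm], ← h1]
    refine integral_congr_ae ?_
    filter_upwards [h.eigen_ae k, h.eigen_ae l] with x hk hl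
    rw [hk, hl]
    rfl
  have hmem : ∀ k, MemLp (fun p : (ℕ → ℝ) × Box d L => p.1 k * ε k p.2) 2 μ := by
    intro k
    rw [memLp_two_iff_integrable_sq (Measurable.aestronglyMeasurable (by
      have := (hεc k).measurable
      fun_prop))]
    have h1 : Integrable (fun ω : ℕ → ℝ => ω k ^ 2) whiteNoise :=
      (memLp_eval_whiteNoise k).integrable_sq
    have h2 : Integrable (fun x => ε k x ^ 2) :=
      ((hεc k).pow 2).integrable_of_hasCompactSupport (HasCompactSupport.of_compactSpace _)
    simpa only [mul_pow] using h1.mul_prod h2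
  set w : ℕ → Lp ℝ 2 μ := fun k => (hmem k).toLp with hw
  have hwae : ∀ k, w k =ᵐ[μ] fun p => p.1 k * ε k p.2 := fun k => (hmem k).coeFn_toLp
  have hortho : Orthonormal ℝ w := by
    rw [orthonormal_iff_ite]
    intro k l
    rw [L2.inner_def]
    calc _ = ∫ p : (ℕ → ℝ) × Box d L, (p.1 k * p.1 l) * (ε k p.2 * ε l p.2) ∂μ := by
          refine integral_congr_ae ?_
          filter_upwards [hwae k, hwae l] with p hk hl
          simp only [hk, hl, RCLike.inner_apply, conj_trivial]
          ring
      _ = _ := by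
          rw [hμ, integral_prod_mul (fun ω : ℕ → ℝ => ω k * ω l) (fun x => ε k x * ε l x), hεi,
            integral_eval_mul_eval_whiteNoise]
          split_ifs <;> simp
  have hmemℓ : Memℓp (fun k => Real.sqrt (lam k)) 2 := by
    refine memℓp_gen (h.summable.congr fun k => ?_)
    simp [Real.sq_sqrt (h.pos k).le]
  have hsum := hortho.orthogonalFamily.hasSum_linearIsometry (⟨_, hmemℓ⟩ : SeqSpace)
  set g : Lp ℝ 2 μ := hortho.orthogonalFamily.linearIsometry (⟨_, hmemℓ⟩ : SeqSpace) with hg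
  have hsum' : HasSum (fun k => Real.sqrt (lam k) • w k) g := by simpa using! hsum
  have htm : TendstoInMeasure μ (fun (N : ℕ) p => ∑ k ∈ Finset.range N,
      Real.sqrt (lam k) * (p.1 k * ε k p.2)) atTop g :=
    (tendstoInMeasure_of_tendsto_Lp hsum'.tendsto_sum_nat).congr
      (fun N => coeFn_sum_smul_ae w hwae _ N) (ae_eq_refl _)
  obtain ⟨ns, hns, hlim⟩ := htm.exists_seq_tendsto_ae
  refine ⟨fun ω x => g (ω, x), (Lp.stronglyMeasurable g).measurable, ?_, ?_⟩
  · filter_upwards [Measure.ae_ae_of_ae_prod hlim, h.ae_hasSum_freeField] with ω h1 h2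
    refine ae_eq_of_hasSum_of_tendsto (f := ε) h.eigen_ae h2 hns ?_
    filter_upwards [h1] with x hx
    refine hx.congr fun i => Finset.sum_congr rfl fun k _ => ?_
    ring
  · have hlim' : ∀ᵐ q : Box d L × (ℕ → ℝ) ∂(volume.prod whiteNoise),
        Tendsto (fun i => ∑ k ∈ Finset.range (ns i), Real.sqrt (lam k) * (q.2 k * ε k q.1)) atTop
          (𝓝 (g (q.2, q.1))) :=
      (Measure.measurePreserving_swap (μ := (volume : Measure (Box d L)))
        (ν := whiteNoise)).quasiMeasurePreserving.ae hlim
    filter_upwards [Measure.ae_ae_of_ae_prod hlim'] with x hx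
    refine isonormal_ae_eq_of_tendsto _ hns ?_
    filter_upwards [hx] with ω hω
    refine hω.congr fun i => Finset.sum_congr rfl fun k _ => ?_
    rw [fieldVec_apply, hε]
    have h0 : Real.sqrt (lam k) ≠ 0 := (Real.sqrt_pos.2 (h.pos k)).ne'
    have h1 : lam k ≠ 0 := (h.pos k).ne'
    field_simp
    rw [Real.sq_sqrt (h.pos k).le]
    field_simp

end Diagonalizes

end FreeField

/-! ### The terms of the series as moments of the interaction -/

section Moments

theorem measurable_inv_covMatrix {d : ℕ} {L : ℝ} (G : C(Box d L, ℝ)) {n : ℕ} (a b : Fin n) :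
    Measurable fun x : Fin n → Box d L => (covMatrix G x)⁻¹ a b := by
  have h1 : Continuous fun x : Fin n → Box d L => (covMatrix G x).adjugate a b :=
    ((continuous_covMatrix G n).matrix_adjugate).matrix_elem a b
  have h2 : Continuous fun x : Fin n → Box d L => (covMatrix G x).det :=
    (continuous_covMatrix G n).matrix_det
  simp only [Matrix.inv_def, Ring.inverse_eq_inv', Matrix.smul_apply, smul_eq_mul]
  exact h2.measurable.inv.mul h1.measurable

variable {d : ℕ} {L : ℝ} [Fact (0 < L)] {G : C(Box d L, ℝ)}
  {e : HilbertBasis ℕ ℝ (FieldSpace d L)} {lam : ℕ → ℝ}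

/-- The interaction `∫ |φ| ^ α`, without the coupling constant. The integral is finite for all
square-integrable fields when `0 ≤ α ≤ 2`. -/
def interaction (α : ℝ) (φ : FieldSpace d L) : ℝ := ∫ x, |φ x| ^ α

theorem interaction_nonneg (α : ℝ) (φ : FieldSpace d L) : 0 ≤ interaction α φ :=
  integral_nonneg fun x => by positivity

theorem memLp_field {α : ℝ} (hα : α ≤ 2) (φ : FieldSpace d L) :
    MemLp φ (ENNReal.ofReal α) volume :=
  (Lp.memLp φ).mono_exponent (by
    rw [← ENNReal.ofReal_ofNat 2]; exact ENNReal.ofReal_le_ofReal hα)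

theorem integrable_abs_rpow {α : ℝ} (hα₀ : 0 ≤ α) (hα : α ≤ 2) (φ : FieldSpace d L) :
    Integrable fun x => |φ x| ^ α := by
  have h := (memLp_field hα φ).integrable_norm_rpow'
  simpa [ENNReal.toReal_ofReal hα₀] using h

/-- The interaction is a power of the `L^α` norm, which is dominated by the `L²` norm. -/
theorem continuous_interaction {α : ℝ} (hα₁ : 1 ≤ α) (hα₂ : α ≤ 2) :
    Continuous (interaction α : FieldSpace d L → ℝ) := by
  set q : ℝ≥0∞ := ENNReal.ofReal α with hq
  have hq1 : 1 ≤ q := by rw [hq, ← ENNReal.ofReal_one]; exact ENNReal.ofReal_le_ofReal hα₁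
  have hq2 : q ≤ 2 := by
    rw [hq, ← ENNReal.ofReal_ofNat 2]; exact ENNReal.ofReal_le_ofReal hα₂
  have : Fact (1 ≤ q) := ⟨hq1⟩
  let inc : FieldSpace d L →+ Lp ℝ q (volume : Measure (Box d L)) :=
    AddSubgroup.inclusion (Lp.antitone hq2)
  have hinc : ∀ φ, (inc φ : Box d L → ℝ) = φ := fun φ => rfl
  have hcont : Continuous inc := by
    set C : ℝ≥0∞ := (volume : Measure (Box d L)) Set.univ ^ (1 / q.toReal - 1 / (2 : ℝ≥0∞).toReal)
      with hC
    refine AddMonoidHomClass.continuous_of_bound inc C.toReal fun φ => ?_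
    have hCt : C ≠ ∞ := by
      refine ENNReal.rpow_ne_top_of_nonneg ?_ (measure_ne_top _ _)
      rw [hq, ENNReal.toReal_ofReal (by linarith), sub_nonneg]
      exact one_div_le_one_div_of_le (by linarith) (by simpa using hα₂)
    rw [Lp.norm_def, Lp.norm_def, hinc, mul_comm, ← ENNReal.toReal_mul]
    exact ENNReal.toReal_mono (ENNReal.mul_ne_top (Lp.eLpNorm_ne_top φ) hCt)
      (eLpNorm_le_eLpNorm_mul_rpow_measure_univ hq2 (Lp.aestronglyMeasurable φ))
  have heq : (interaction α : FieldSpace d L → ℝ) = fun φ => ‖inc φ‖ ^ α := by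
    ext φ
    have h0 : 0 ≤ ∫ x, |φ x| ^ α := interaction_nonneg α φ
    rw [Lp.norm_def, hinc, (memLp_field hα₂ φ).eLpNorm_eq_integral_rpow_norm
      (by rw [← hq]; exact (zero_lt_one.trans_le hq1).ne') ENNReal.ofReal_ne_top,
      ENNReal.toReal_ofReal (by positivity), ENNReal.toReal_ofReal (by linarith),
      ← Real.rpow_mul (by simpa using h0), inv_mul_cancel₀ (by linarith), Real.rpow_one]
    rfl
  rw [heq]
  exact hcont.norm.rpow_const fun _ => Or.inr (by linarith)

theorem measurable_termIntegrand (α : ℝ) (j : FieldSpace d L) (n : ℕ) :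
    Measurable fun p : (Fin n → Box d L) × (Fin n → ℝ) => termIntegrand G α j p.1 p.2 := by
  have h2 : Measurable fun x : Fin n → Box d L => (covMatrix G x).det :=
    (continuous_covMatrix G n).matrix_det.measurable
  have h3 : ∀ a, Measurable fun p : (Fin n → Box d L) × (Fin n → ℝ) =>
      p.2 a - classicalField G j (p.1 a) := fun a =>
    (by fun_prop : Continuous fun p : (Fin n → Box d L) × (Fin n → ℝ) =>
      p.2 a - classicalField G j (p.1 a)).measurable
  have h4 : Measurable fun p : (Fin n → Box d L) × (Fin n → ℝ) => ∑ a, ∑ b,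
      (covMatrix G p.1)⁻¹ a b * (p.2 a - classicalField G j (p.1 a)) *
        (p.2 b - classicalField G j (p.1 b)) :=
    Finset.measurable_fun_sum _ fun a _ => Finset.measurable_fun_sum _ fun b _ =>
      (((measurable_inv_covMatrix G a b).comp measurable_fst).mul (h3 a)).mul (h3 b)
  have h5 : Measurable fun p : (Fin n → Box d L) × (Fin n → ℝ) => (covMatrix G p.1).det :=
    h2.comp measurable_fst
  unfold termIntegrand
  fun_prop

theorem termIntegrand_nonneg (α : ℝ) (j : FieldSpace d L) {n : ℕ} (x : Fin n → Box d L)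
    (φ : Fin n → ℝ) : 0 ≤ termIntegrand G α j x φ := by
  unfold termIntegrand
  have : 0 ≤ ∏ a, |φ a| ^ α := Finset.prod_nonneg fun _ _ => by positivity
  positivity

theorem ae_forall_eval {n : ℕ} {p : Box d L → Prop} (hp : ∀ᵐ x, p x) :
    ∀ᵐ x : Fin n → Box d L, ∀ a, p (x a) :=
  ae_all_iff.2 fun a => (Measure.quasiMeasurePreserving_eval (fun _ => volume) a).ae hp

namespace Diagonalizes

variable (h : Diagonalizes G e lam)
include h

theorem aemeasurable_interaction {α : ℝ} (hα₁ : 1 ≤ α) (hα₂ : α ≤ 2) :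
    AEMeasurable (fun ω => interaction α (freeField e lam ω)) whiteNoise :=
  (continuous_interaction hα₁ hα₂).measurable.comp_aemeasurable h.aemeasurable_freeField

/-- The inner Gaussian integral of the `n`-th term is a tilted moment of the values of the free
field. -/
theorem lintegral_termIntegrand {n : ℕ} {x : Fin n → Box d L} (hx : (covMatrix G x).PosDef)
    (α : ℝ) (j : FieldSpace d L) :
    ∫⁻ φ, ENNReal.ofReal (termIntegrand G α j x φ) =
      ∫⁻ ω, ENNReal.ofReal (∏ a, |isonormal (fieldVec h (x a)) ω| ^ α)
        ∂tiltedNoise (sourceVec h j) := by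
  have hx' := hx
  rw [h.covMatrix_eq_gram] at hx'
  rw [lintegral_isonormal_tilt (sourceVec h j) (fun a => fieldVec h (x a)) hx'
    (f := fun φ => ENNReal.ofReal (∏ a, |φ a| ^ α)) (by fun_prop), ← h.covMatrix_eq_gram]
  -- the tilt shifts the mean by `-classicalField G j`; reflect `φ`
  rw [← lintegral_neg_eq_self]
  refine lintegral_congr fun φ => ?_
  rw [← ENNReal.ofReal_mul (Finset.prod_nonneg fun _ _ => by positivity), termIntegrand]
  simp only [h.inner_fieldVec_sourceVec, Pi.neg_apply, abs_neg, mul_assoc]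
  congr 6
  ext a
  refine Finset.sum_congr rfl fun b _ => ?_
  ring

/-- The `n`-th moment of the interaction under the tilted measure, computed by Fubini's theorem. -/
theorem lintegral_interaction_pow (hd : 1 ≤ d) {α : ℝ} (hα₁ : 1 ≤ α) (hα₂ : α ≤ 2) (n : ℕ)
    (j : FieldSpace d L) :
    ∫⁻ ω, ENNReal.ofReal (interaction α (freeField e lam ω) ^ n) ∂tiltedNoise (sourceVec h j) =
      ∫⁻ x : Fin n → Box d L, ∫⁻ φ, ENNReal.ofReal (termIntegrand G α j x φ) := by
  obtain ⟨Φ, hΦm, hΦω, hΦx⟩ := h.exists_measurable_field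
  have hac := tiltedNoise_absolutelyContinuous (sourceVec h j)
  have hm : Measurable fun p : (ℕ → ℝ) × (Fin n → Box d L) =>
      ENNReal.ofReal (∏ a, |Φ p.1 (p.2 a)| ^ α) := by
    refine Measurable.ennreal_ofReal (Finset.measurable_fun_prod _ fun a _ => ?_)
    have : Measurable fun p : (ℕ → ℝ) × (Fin n → Box d L) => Φ p.1 (p.2 a) :=
      hΦm.comp (by fun_prop : Measurable fun p : (ℕ → ℝ) × (Fin n → Box d L) => (p.1, p.2 a))
    fun_prop
  calc _ = ∫⁻ ω, (∫⁻ x : Fin n → Box d L, ENNReal.ofReal (∏ a, |Φ ω (x a)| ^ α))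
        ∂tiltedNoise (sourceVec h j) := by
        refine lintegral_congr_ae (hac.ae_le ?_)
        filter_upwards [hΦω] with ω hω
        have h1 : (fun x => |freeField e lam ω x| ^ α) =ᵐ[volume] fun x => |Φ ω x| ^ α := by
          filter_upwards [hω] with x hx
          rw [hx]
        have hint : Integrable fun x => |Φ ω x| ^ α :=
          (integrable_abs_rpow (by linarith) hα₂ _).congr h1
        have h2 : interaction α (freeField e lam ω) ^ n =
            ∫ x : Fin n → Box d L, ∏ a, |Φ ω (x a)| ^ α := by
          rw [integral_fintype_prod_volume_eq_pow (fun x => |Φ ω x| ^ α), Fintype.card_fin,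
            interaction, integral_congr_ae h1]
        have h3 : Integrable fun x : Fin n → Box d L => ∏ a, |Φ ω (x a)| ^ α :=
          Integrable.fintype_prod fun _ => hint
        rw [h2, ofReal_integral_eq_lintegral_ofReal h3
          (Eventually.of_forall fun x => Finset.prod_nonneg fun _ _ => by positivity)]
    _ = ∫⁻ x : Fin n → Box d L, ∫⁻ ω, ENNReal.ofReal (∏ a, |Φ ω (x a)| ^ α)
        ∂tiltedNoise (sourceVec h j) := lintegral_lintegral_swap hm.aemeasurable
    _ = _ := by
        refine lintegral_congr_ae ?_
        filter_upwards [h.ae_posDef_covMatrix hd n, ae_forall_eval hΦx] with x hx hx'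
        rw [h.lintegral_termIntegrand hx]
        refine lintegral_congr_ae (hac.ae_le ?_)
        filter_upwards [ae_all_iff.2 hx'] with ω hω
        simp only [hω]

/-- The bound for the `n`-th moment of the interaction that results from Hölder's inequality, all
values of the free field having the variance `G 0`. -/
theorem lintegral_lintegral_termIntegrand_le (hd : 1 ≤ d) {α : ℝ} (hα : 0 ≤ α) {n : ℕ}
    (hn : 1 ≤ n) (j : FieldSpace d L) :
    ∫⁻ x : Fin n → Box d L, ∫⁻ φ, ENNReal.ofReal (termIntegrand G α j x φ) ≤
      ENNReal.ofReal (G 0 ^ (n * α / 2) *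
        Real.sqrt (2 ^ (n * α) * Real.Gamma (n * α + 1 / 2) / Real.sqrt Real.pi) *
        Real.exp (‖sourceVec h j‖ ^ 2 / 2) * (L ^ d) ^ n) := by
  have hG : 0 ≤ G 0 := by rw [← h.norm_fieldVec_sq 0]; positivity
  have hL : 0 < L := Fact.out
  have hvol : (volume : Measure (Fin n → Box d L)) Set.univ = ENNReal.ofReal ((L ^ d) ^ n) := by
    rw [volume_pi, Measure.pi_univ]
    simp only [volume_pi, Measure.pi_univ, AddCircle.measure_univ, Finset.prod_const,
      Finset.card_univ, Fintype.card_fin]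
    rw [← ENNReal.ofReal_pow hL.le, ← ENNReal.ofReal_pow (by positivity)]
  calc _ ≤ ∫⁻ _ : Fin n → Box d L, ENNReal.ofReal (Real.sqrt (G 0) ^ (n * α) *
        Real.sqrt (2 ^ (n * α) * Real.Gamma (n * α + 1 / 2) / Real.sqrt Real.pi) *
        Real.exp (‖sourceVec h j‖ ^ 2 / 2)) := by
        refine lintegral_mono_ae ?_
        filter_upwards [h.ae_posDef_covMatrix hd n] with x hx
        rw [h.lintegral_termIntegrand hx]
        exact lintegral_prod_abs_rpow_isonormal_le hn _ _ (fun a => h.norm_fieldVec (x a)) hα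
    _ = _ := by
        rw [lintegral_const, hvol, ← ENNReal.ofReal_mul (by positivity), Real.sqrt_eq_rpow,
          ← Real.rpow_mul hG]
        congr 5
        ring

theorem lintegral_lintegral_termIntegrand_lt_top (hd : 1 ≤ d) {α : ℝ} (hα₁ : 1 ≤ α) (hα₂ : α ≤ 2)
    (n : ℕ) (j : FieldSpace d L) :
    ∫⁻ x : Fin n → Box d L, ∫⁻ φ, ENNReal.ofReal (termIntegrand G α j x φ) < ∞ := by
  rcases Nat.eq_zero_or_pos n with rfl | hn
  · rw [← h.lintegral_interaction_pow hd hα₁ hα₂]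
    simp
  · exact (h.lintegral_lintegral_termIntegrand_le hd (by linarith) hn j).trans_lt
      ENNReal.ofReal_lt_top

theorem integrable_termIntegrand (hd : 1 ≤ d) {α : ℝ} (hα₁ : 1 ≤ α) (hα₂ : α ≤ 2)
    (n : ℕ) (j : FieldSpace d L) :
    Integrable (fun p : (Fin n → Box d L) × (Fin n → ℝ) => termIntegrand G α j p.1 p.2) := by
  have hm := measurable_termIntegrand (G := G) α j n
  refine ⟨hm.aestronglyMeasurable, ?_⟩
  rw [hasFiniteIntegral_iff_ofReal (Eventually.of_forall fun p => termIntegrand_nonneg α j _ _),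
    Measure.volume_eq_prod, lintegral_prod _ hm.ennreal_ofReal.aemeasurable]
  exact h.lintegral_lintegral_termIntegrand_lt_top hd hα₁ hα₂ n j

theorem integrable_interaction_pow (hd : 1 ≤ d) {α : ℝ} (hα₁ : 1 ≤ α) (hα₂ : α ≤ 2) (n : ℕ)
    (j : FieldSpace d L) :
    Integrable (fun ω => interaction α (freeField e lam ω) ^ n)
      (tiltedNoise (sourceVec h j)) := by
  refine ⟨(((h.aemeasurable_interaction hα₁ hα₂).mono_ac
    (tiltedNoise_absolutelyContinuous _)).pow_const n).aestronglyMeasurable, ?_⟩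
  rw [hasFiniteIntegral_iff_ofReal (Eventually.of_forall fun ω =>
    pow_nonneg (interaction_nonneg α _) n), h.lintegral_interaction_pow hd hα₁ hα₂]
  exact h.lintegral_lintegral_termIntegrand_lt_top hd hα₁ hα₂ n j

theorem integral_interaction_pow (hd : 1 ≤ d) {α : ℝ} (hα₁ : 1 ≤ α) (hα₂ : α ≤ 2) (n : ℕ)
    (j : FieldSpace d L) :
    ∫ ω, interaction α (freeField e lam ω) ^ n ∂tiltedNoise (sourceVec h j) =
      ∫ x : Fin n → Box d L, ∫ φ, termIntegrand G α j x φ := by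
  have hm := measurable_termIntegrand (G := G) α j n
  have hint := h.integrable_termIntegrand hd hα₁ hα₂ n j
  rw [Measure.volume_eq_prod] at hint
  rw [← integral_prod (f := fun p : (Fin n → Box d L) × (Fin n → ℝ) =>
      termIntegrand G α j p.1 p.2) hint,
    integral_eq_lintegral_of_nonneg_ae (Eventually.of_forall fun ω =>
      pow_nonneg (interaction_nonneg α _) n)
      (h.integrable_interaction_pow hd hα₁ hα₂ n j).aestronglyMeasurable,
    integral_eq_lintegral_of_nonneg_ae (Eventually.of_forall fun p => termIntegrand_nonneg α j _ _)
      hint.aestronglyMeasurable, lintegral_prod _ hm.ennreal_ofReal.aemeasurable,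
    h.lintegral_interaction_pow hd hα₁ hα₂]

/-- The terms of the series are those of the expansion of `exp (-g ∫ |φ| ^ α)` under the
expectation. -/
theorem seriesTerm_eq (hd : 1 ≤ d) {α : ℝ} (hα₁ : 1 ≤ α) (hα₂ : α ≤ 2) (g : ℝ) (n : ℕ)
    (j : FieldSpace d L) :
    seriesTerm G α g n j = ∫ ω, (-g) ^ n / (n.factorial : ℝ) *
      interaction α (freeField e lam ω) ^ n ∂tiltedNoise (sourceVec h j) := by
  rw [integral_const_mul, h.integral_interaction_pow hd hα₁ hα₂, seriesTerm]

end Diagonalizes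

end Moments

/-! ### Absolute Gaussian moments and the coefficient of the majorant -/

section GammaBounds

/-- Logarithmic convexity of the Gamma function at a midpoint. -/
theorem Gamma_midpoint_sq_le {x y : ℝ} (hx : 0 < x) (hy : 0 < y) :
    Real.Gamma ((x + y) / 2) ^ 2 ≤ Real.Gamma x * Real.Gamma y := by
  have h := Real.Gamma_mul_add_mul_le_rpow_Gamma_mul_rpow_Gamma hx hy
    (a := 1 / 2) (b := 1 / 2) (by norm_num) (by norm_num) (by norm_num)
  rw [show 1 / 2 * x + 1 / 2 * y = (x + y) / 2 by ring, ← Real.sqrt_eq_rpow,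
    ← Real.sqrt_eq_rpow] at h
  have h1 := Real.Gamma_pos_of_pos hx
  have h2 := Real.Gamma_pos_of_pos hy
  calc _ ≤ (Real.sqrt (Real.Gamma x) * Real.sqrt (Real.Gamma y)) ^ 2 :=
        pow_le_pow_left₀ (Real.Gamma_pos_of_pos (by linarith)).le h 2
    _ = _ := by rw [mul_pow, Real.sq_sqrt h1.le, Real.sq_sqrt h2.le]

theorem mul_Gamma_add_half_sq_le {p : ℝ} (hp : 0 < p) :
    p * Real.Gamma (p + 1 / 2) ^ 2 ≤ Real.Gamma (p + 1) ^ 2 := by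
  have h := Gamma_midpoint_sq_le hp (by linarith : 0 < p + 1)
  rw [show (p + (p + 1)) / 2 = p + 1 / 2 by ring] at h
  calc _ ≤ p * (Real.Gamma p * Real.Gamma (p + 1)) := mul_le_mul_of_nonneg_left h hp.le
    _ = _ := by rw [Real.Gamma_add_one hp.ne']; ring

theorem factorial_mul_Gamma_le {p : ℝ} (hp : 0 < p) (m : ℕ) :
    (m.factorial : ℝ) * Real.Gamma (p + 1) ≤ Real.Gamma (p + (m + 1 : ℕ)) := by
  induction m with
  | zero => simp
  | succ m ih =>
    have h1 : p + ((m + 1 + 1 : ℕ) : ℝ) = (p + (m + 1 : ℕ)) + 1 := by push_cast; ring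
    rw [h1, Real.Gamma_add_one (s := p + (m + 1 : ℕ)) (by positivity), Nat.factorial_succ]
    push_cast at ih ⊢
    have h2 : 0 < Real.Gamma (p + 1) := Real.Gamma_pos_of_pos (by linarith)
    rw [mul_assoc]
    exact mul_le_mul (by linarith) ih (by positivity) (by positivity)

/-- The absolute Gaussian moment is bounded by the ratio of Gamma functions of the majorant. -/
theorem Gamma_add_half_mul_sq_le {n : ℕ} (hn : 1 ≤ n) {p : ℝ} (hp : 1 ≤ p) :
    Real.Gamma (p + 1 / 2) * Real.Gamma ((n : ℝ) / 2 + 1) ^ 2 ≤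
      (n : ℝ) ^ 2 * Real.Gamma (p + n) := by
  have hp0 : 0 < p := by linarith
  have h1 : Real.Gamma (p + 1 / 2) ≤ Real.Gamma (p + 1) := by
    have h := mul_Gamma_add_half_sq_le hp0
    have h2 : 0 < Real.Gamma (p + 1) := Real.Gamma_pos_of_pos (by linarith)
    refine le_of_sq_le_sq ?_ h2.le
    nlinarith [sq_nonneg (Real.Gamma (p + 1 / 2))]
  have h2 : Real.Gamma ((n : ℝ) / 2 + 1) ^ 2 ≤ n.factorial := by
    have h := Gamma_midpoint_sq_le one_pos (by positivity : (0 : ℝ) < n + 1)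
    rwa [show (1 + ((n : ℝ) + 1)) / 2 = (n : ℝ) / 2 + 1 by ring, Real.Gamma_one, one_mul,
      Real.Gamma_nat_eq_factorial] at h
  obtain ⟨m, rfl⟩ : ∃ m, n = m + 1 := ⟨n - 1, by omega⟩
  have h3 := factorial_mul_Gamma_le hp0 m
  have h4 : 0 < Real.Gamma (p + 1) := Real.Gamma_pos_of_pos (by linarith)
  have hm : (1 : ℝ) ≤ (m + 1 : ℕ) := by exact_mod_cast Nat.le_add_left 1 m
  calc _ ≤ Real.Gamma (p + 1) * (m + 1).factorial :=
        mul_le_mul h1 h2 (sq_nonneg _) h4.le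
    _ = (m + 1 : ℕ) * ((m.factorial : ℝ) * Real.Gamma (p + 1)) := by
        rw [Nat.factorial_succ]; push_cast; ring
    _ ≤ (m + 1 : ℕ) * Real.Gamma (p + (m + 1 : ℕ)) := mul_le_mul_of_nonneg_left h3 (by positivity)
    _ ≤ _ := by
        refine mul_le_mul_of_nonneg_right ?_ (Real.Gamma_pos_of_pos (by positivity)).le
        nlinarith

/-- The constant of the moment bound is dominated by the coefficient of the majorant. -/
theorem moment_le_majorantCoeff {α : ℝ} (hα : 1 ≤ α) {n : ℕ} (hn : 1 ≤ n) :
    (1 / (n.factorial : ℝ)) *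
      Real.sqrt (2 ^ (n * α) * Real.Gamma (n * α + 1 / 2) / Real.sqrt Real.pi) ≤
        majorantCoeff α n := by
  have hn1 : (1 : ℝ) ≤ n := by exact_mod_cast hn
  have hp : 1 ≤ n * α := by nlinarith
  have hΓ : 0 < Real.Gamma ((n : ℝ) / 2 + 1) := Real.Gamma_pos_of_pos (by positivity)
  have hΓp : 0 < Real.Gamma (n * α + 1 / 2) := Real.Gamma_pos_of_pos (by positivity)
  have hΓn : 0 < Real.Gamma (n * (α + 1)) := Real.Gamma_pos_of_pos (by positivity)
  rw [majorantCoeff]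
  refine mul_le_mul_of_nonneg_left ?_ (by positivity)
  rw [le_div_iff₀ hΓ]
  have hpi : 1 ≤ Real.sqrt Real.pi := Real.one_le_sqrt.2 (by linarith [Real.pi_gt_three])
  have h1 : Real.sqrt (2 ^ (n * α) * Real.Gamma (n * α + 1 / 2) / Real.sqrt Real.pi) ≤
      2 ^ (n * α / 2) * Real.sqrt (Real.Gamma (n * α + 1 / 2)) := by
    have h4 : (2 : ℝ) ^ (n * α / 2) = Real.sqrt (2 ^ (n * α)) := by
      rw [Real.sqrt_eq_rpow, ← Real.rpow_mul (by norm_num)]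
      ring_nf
    rw [h4, ← Real.sqrt_mul (by positivity)]
    exact Real.sqrt_le_sqrt (div_le_self (by positivity) hpi)
  have h2 : Real.sqrt (Real.Gamma (n * α + 1 / 2)) * Real.Gamma ((n : ℝ) / 2 + 1) ≤
      n * Real.sqrt (Real.Gamma (n * (α + 1))) := by
    refine le_of_sq_le_sq ?_ (by positivity)
    rw [mul_pow, mul_pow, Real.sq_sqrt hΓp.le, Real.sq_sqrt hΓn.le,
      show n * (α + 1) = n * α + n by ring]
    exact Gamma_add_half_mul_sq_le hn hp
  have h3 : (2 : ℝ) ^ (n * α / 2) ≤ Real.pi ^ ((n : ℝ) / 2) * 2 ^ ((n * α + n) / 2) := by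
    have h4 : (1 : ℝ) ≤ Real.pi ^ ((n : ℝ) / 2) :=
      Real.one_le_rpow (by linarith [Real.pi_gt_three]) (by positivity)
    have h5 : (2 : ℝ) ^ (n * α / 2) ≤ 2 ^ ((n * α + n) / 2) :=
      Real.rpow_le_rpow_of_exponent_le (by norm_num) (by linarith)
    calc (2 : ℝ) ^ (n * α / 2) ≤ 1 * 2 ^ ((n * α + n) / 2) := by rwa [one_mul]
      _ ≤ _ := mul_le_mul_of_nonneg_right h4 (by positivity)
  calc _ ≤ 2 ^ (n * α / 2) * Real.sqrt (Real.Gamma (n * α + 1 / 2)) *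
        Real.Gamma ((n : ℝ) / 2 + 1) := mul_le_mul_of_nonneg_right h1 hΓ.le
    _ = 2 ^ (n * α / 2) * (Real.sqrt (Real.Gamma (n * α + 1 / 2)) *
        Real.Gamma ((n : ℝ) / 2 + 1)) := by ring
    _ ≤ (Real.pi ^ ((n : ℝ) / 2) * 2 ^ ((n * α + n) / 2)) *
        (n * Real.sqrt (Real.Gamma (n * (α + 1)))) :=
      mul_le_mul h3 h2 (by positivity) (by positivity)
    _ = _ := by ring

/-- A crude upper Stirling bound: logarithmic convexity gives it on `[1, 2]`, and the functional
equation propagates it. -/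
theorem Gamma_le_rpow_self {x : ℝ} (hx : 1 ≤ x) : Real.Gamma x ≤ x ^ x := by
  suffices H : ∀ (n : ℕ) (y : ℝ), 1 ≤ y → y ≤ n + 2 → Real.Gamma y ≤ y ^ y by
    obtain ⟨n, hn⟩ := exists_nat_ge x
    exact H n x hx (by linarith)
  intro n
  induction n with
  | zero =>
    intro y hy1 hy2
    push_cast at hy2
    have h := Real.Gamma_mul_add_mul_le_rpow_Gamma_mul_rpow_Gamma one_pos two_pos
      (a := 2 - y) (b := y - 1)
    have h1 : Real.Gamma y ≤ 1 := by
      rcases hy1.eq_or_lt with rfl | hy1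
      · simp
      rcases (show y ≤ 2 by linarith).eq_or_lt with rfl | hy2
      · simp
      have h := h (by linarith) (by linarith) (by ring)
      rwa [show (2 - y) * 1 + (y - 1) * 2 = y by ring, Real.Gamma_one, Real.Gamma_two,
        Real.one_rpow, Real.one_rpow, mul_one] at h
    exact h1.trans (Real.one_le_rpow hy1 (by linarith))
  | succ n ih =>
    intro y hy1 hy2
    rcases le_or_gt y (n + 2) with hy | hy
    · exact ih y hy1 hy
    · have hy' : 1 ≤ y - 1 := by have : (0 : ℝ) ≤ n := by positivity
                                 linarith
      have h := ih (y - 1) hy' (by push_cast at hy2; linarith)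
      calc Real.Gamma y = (y - 1) * Real.Gamma (y - 1) := by
            rw [← Real.Gamma_add_one (by linarith), sub_add_cancel]
        _ ≤ (y - 1) * (y - 1) ^ (y - 1) := mul_le_mul_of_nonneg_left h (by linarith)
        _ = (y - 1) ^ y := by
            rw [← Real.rpow_one_add' (by linarith) (by linarith), add_sub_cancel]
        _ ≤ y ^ y := Real.rpow_le_rpow (by linarith) (by linarith) (by linarith)

theorem natCast_rpow_le_factorial (n : ℕ) : (n : ℝ) ^ (n : ℝ) ≤ Real.exp 1 ^ n * n.factorial := by
  have h := Real.pow_div_factorial_le_exp (n : ℝ) (by positivity) n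
  rw [div_le_iff₀ (by positivity)] at h
  rw [Real.rpow_natCast, ← Real.exp_nat_mul, mul_one]
  exact h

/-- A Stirling type lower bound, from the duplication formula. -/
theorem factorial_le_Gamma_half_sq {n : ℕ} (hn : 1 ≤ n) :
    (n.factorial : ℝ) ≤ 2 ^ n * Real.Gamma ((n : ℝ) / 2 + 1) ^ 2 := by
  have hn1 : (1 : ℝ) ≤ n := by exact_mod_cast hn
  have h := Real.Gamma_mul_Gamma_add_half ((n : ℝ) / 2 + 1 / 2)
  rw [show (n : ℝ) / 2 + 1 / 2 + 1 / 2 = (n : ℝ) / 2 + 1 by ring,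
    show 2 * ((n : ℝ) / 2 + 1 / 2) = n + 1 by ring, Real.Gamma_nat_eq_factorial,
    show (1 : ℝ) - (n + 1) = -n by ring, Real.rpow_neg (by norm_num), Real.rpow_natCast] at h
  have h1 := mul_Gamma_add_half_sq_le (p := (n : ℝ) / 2) (by positivity)
  set a := Real.Gamma ((n : ℝ) / 2 + 1 / 2)
  set b := Real.Gamma ((n : ℝ) / 2 + 1)
  have ha : 0 < a := Real.Gamma_pos_of_pos (by positivity)
  have hb : 0 < b := Real.Gamma_pos_of_pos (by positivity)
  have h2 : a ≤ Real.sqrt 2 * b := by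
    refine le_of_sq_le_sq ?_ (by positivity)
    rw [mul_pow, Real.sq_sqrt (by norm_num)]
    nlinarith [sq_nonneg a]
  have h3 : Real.sqrt 2 ≤ Real.sqrt Real.pi := Real.sqrt_le_sqrt (by linarith [Real.pi_gt_three])
  have h4 : (n.factorial : ℝ) * Real.sqrt Real.pi = 2 ^ n * (a * b) := by
    rw [h]; field_simp
  have h5 : (n.factorial : ℝ) * Real.sqrt 2 ≤ 2 ^ n * (Real.sqrt 2 * b * b) :=
    calc _ ≤ (n.factorial : ℝ) * Real.sqrt Real.pi := mul_le_mul_of_nonneg_left h3 (by positivity)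
      _ = _ := h4
      _ ≤ _ := by gcongr
  have h6 : (0 : ℝ) < Real.sqrt 2 := by positivity
  refine le_of_mul_le_mul_right ?_ h6
  calc _ ≤ _ := h5
    _ = _ := by ring

end GammaBounds

/-! ### The majorant of the series -/

section Majorant

/-- The growth rate of the majorant, a Stirling estimate for its Gamma functions. -/
theorem exists_majorantCoeff_le {α : ℝ} (hα : 1 ≤ α) : ∃ A : ℝ, 0 < A ∧ ∀ n : ℕ, 1 ≤ n →
    majorantCoeff α n ≤ A ^ n * (n : ℝ) ^ (n * α / 2 - n) := by
  refine ⟨Real.exp 1 * 2 * Real.pi ^ (1 / 2 : ℝ) * 2 ^ ((α + 1) / 2) *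
    (α + 1) ^ ((α + 1) / 2) * (2 * Real.exp 1) ^ (1 / 2 : ℝ), by positivity, fun n hn => ?_⟩
  have hn1 : (1 : ℝ) ≤ n := by exact_mod_cast hn
  have hn0 : (0 : ℝ) < n := by linarith
  have hE : (0 : ℝ) < Real.exp 1 := Real.exp_pos 1
  have hnn := natCast_rpow_le_factorial n
  have hΓ : 0 < Real.Gamma ((n : ℝ) / 2 + 1) := Real.Gamma_pos_of_pos (by positivity)
  have hpow : ∀ {x : ℝ}, 0 ≤ x → ∀ s : ℝ, x ^ (n * s) = (x ^ s) ^ n := fun hx s => by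
    rw [mul_comm, Real.rpow_mul_natCast hx]
  have h1 : 1 / (n.factorial : ℝ) ≤ Real.exp 1 ^ n * (n : ℝ) ^ (-(n : ℝ)) := by
    rw [Real.rpow_neg hn0.le, ← div_eq_mul_inv, div_le_div_iff₀ (by positivity) (by positivity),
      one_mul]
    exact hnn
  have h2 : (n : ℝ) ≤ 2 ^ n := by exact_mod_cast n.lt_two_pow_self.le
  have h3 : Real.pi ^ ((n : ℝ) / 2) = (Real.pi ^ (1 / 2 : ℝ)) ^ n := by
    rw [← hpow Real.pi_pos.le]; ring_nf
  have h4 : (2 : ℝ) ^ ((n * α + n) / 2) = (2 ^ ((α + 1) / 2)) ^ n := by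
    rw [← hpow (by norm_num)]; ring_nf
  have h5 : Real.sqrt (Real.Gamma (n * (α + 1))) ≤
      (n : ℝ) ^ (n * (α + 1) / 2) * ((α + 1) ^ ((α + 1) / 2)) ^ n := by
    have h := Gamma_le_rpow_self (x := n * (α + 1)) (by nlinarith)
    refine (Real.sqrt_le_sqrt h).trans (le_of_eq ?_)
    rw [Real.sqrt_eq_rpow, ← Real.rpow_mul (by positivity), Real.mul_rpow hn0.le (by linarith),
      ← hpow (by linarith)]
    ring_nf
  have h6 : 1 / Real.Gamma ((n : ℝ) / 2 + 1) ≤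
      ((2 * Real.exp 1) ^ (1 / 2 : ℝ)) ^ n * (n : ℝ) ^ (-((n : ℝ) / 2)) := by
    rw [Real.rpow_neg hn0.le, ← div_eq_mul_inv, div_le_div_iff₀ hΓ (by positivity), one_mul]
    refine le_of_sq_le_sq ?_ (by positivity)
    have ha : ((n : ℝ) ^ ((n : ℝ) / 2)) ^ 2 = (n : ℝ) ^ (n : ℝ) := by
      rw [← Real.rpow_mul_natCast hn0.le]
      push_cast; ring_nf
    have hb : (((2 * Real.exp 1) ^ (1 / 2 : ℝ)) ^ n) ^ 2 = (2 * Real.exp 1) ^ n := by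
      rw [pow_right_comm, ← Real.sqrt_eq_rpow, Real.sq_sqrt (by positivity)]
    rw [mul_pow, ha, hb]
    calc _ ≤ _ := hnn
      _ ≤ Real.exp 1 ^ n * (2 ^ n * Real.Gamma ((n : ℝ) / 2 + 1) ^ 2) :=
        mul_le_mul_of_nonneg_left (factorial_le_Gamma_half_sq hn) (by positivity)
      _ = _ := by rw [mul_pow]; ring
  have h7 : (n : ℝ) ^ (n * α / 2 - n) =
      (n : ℝ) ^ (-(n : ℝ)) * (n : ℝ) ^ (n * (α + 1) / 2) * (n : ℝ) ^ (-((n : ℝ) / 2)) := by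
    rw [← Real.rpow_add hn0, ← Real.rpow_add hn0]
    ring_nf
  rw [majorantCoeff, h7, h3, h4]
  calc _ = (1 / (n.factorial : ℝ)) * (n * (Real.pi ^ (1 / 2 : ℝ)) ^ n * (2 ^ ((α + 1) / 2)) ^ n *
        Real.sqrt (Real.Gamma (n * (α + 1))) * (1 / Real.Gamma ((n : ℝ) / 2 + 1))) := by ring
    _ ≤ (Real.exp 1 ^ n * (n : ℝ) ^ (-(n : ℝ))) * (2 ^ n * (Real.pi ^ (1 / 2 : ℝ)) ^ n *
        (2 ^ ((α + 1) / 2)) ^ n * ((n : ℝ) ^ (n * (α + 1) / 2) * ((α + 1) ^ ((α + 1) / 2)) ^ n) *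
        (((2 * Real.exp 1) ^ (1 / 2 : ℝ)) ^ n * (n : ℝ) ^ (-((n : ℝ) / 2)))) := by
      gcongr
    _ = _ := by simp only [mul_pow]; ring

theorem majorantCoeff_nonneg (α : ℝ) (n : ℕ) : 0 ≤ majorantCoeff α n := by
  have : 0 < Real.Gamma ((n : ℝ) / 2 + 1) := Real.Gamma_pos_of_pos (by positivity)
  rw [majorantCoeff]
  positivity

variable {d : ℕ} {L : ℝ} [Fact (0 < L)] {G : C(Box d L, ℝ)}
  {e : HilbertBasis ℕ ℝ (FieldSpace d L)} {lam : ℕ → ℝ}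

/-- For `α < 2` the `n`-th root of the majorant is of order `n ^ (α / 2 - 1)` and tends to zero. -/
theorem summable_majorant {α g : ℝ} (hα₁ : 1 ≤ α) (hα₂ : α < 2) (hg : 0 < g) (hG : 0 ≤ G 0)
    (R : ℝ) : Summable fun n : ℕ => majorant G α g n R := by
  obtain ⟨A, hA, hAn⟩ := exists_majorantCoeff_le hα₁
  have hL : 0 < L := Fact.out
  refine Summable.mul_right _ ?_
  set B : ℝ := A * g * G 0 ^ (α / 2) * L ^ d with hB
  have hB0 : 0 ≤ B := by positivity
  have hlim : Tendsto (fun n : ℕ => B * (n : ℝ) ^ (-(1 - α / 2))) atTop (𝓝 0) := by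
    have h1 := (tendsto_rpow_neg_atTop (y := 1 - α / 2) (by linarith)).comp
      tendsto_natCast_atTop_atTop
    simpa using h1.const_mul B
  refine Summable.of_norm_bounded_eventually_nat (g := fun n => (1 / 2 : ℝ) ^ n)
    (summable_geometric_of_lt_one (by norm_num) (by norm_num)) ?_
  filter_upwards [eventually_ge_atTop 1, hlim.eventually_lt_const (by norm_num : (0 : ℝ) < 1 / 2)]
    with n hn hn2
  have hc := majorantCoeff_nonneg α n
  have h1 : G 0 ^ (n * α / 2) = (G 0 ^ (α / 2)) ^ n := by
    rw [← Real.rpow_mul_natCast hG]; ring_nf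
  have h2 : (n : ℝ) ^ (n * α / 2 - n) = ((n : ℝ) ^ (-(1 - α / 2))) ^ n := by
    rw [← Real.rpow_mul_natCast (by positivity)]; ring_nf
  have h3 := hAn n hn
  rw [h2] at h3
  rw [Real.norm_of_nonneg (by positivity), h1]
  calc _ ≤ A ^ n * ((n : ℝ) ^ (-(1 - α / 2))) ^ n * g ^ n * (G 0 ^ (α / 2)) ^ n * (L ^ d) ^ n := by
        gcongr
    _ = (B * (n : ℝ) ^ (-(1 - α / 2))) ^ n := by rw [hB]; simp only [mul_pow]; ring
    _ ≤ _ := pow_le_pow_left₀ (by positivity) hn2.le n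

namespace Diagonalizes

variable (h : Diagonalizes G e lam)
include h

theorem kernel_zero_nonneg : 0 ≤ G 0 := by
  rw [← h.norm_fieldVec_sq 0]; positivity

theorem abs_seriesTerm (hd : 1 ≤ d) {α g : ℝ} (hα₁ : 1 ≤ α) (hα₂ : α ≤ 2) (hg : 0 ≤ g) (n : ℕ)
    (j : FieldSpace d L) :
    |seriesTerm G α g n j| = g ^ n / (n.factorial : ℝ) *
      ∫ ω, interaction α (freeField e lam ω) ^ n ∂tiltedNoise (sourceVec h j) := by
  have h0 : 0 ≤ ∫ ω, interaction α (freeField e lam ω) ^ n ∂tiltedNoise (sourceVec h j) :=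
    integral_nonneg fun ω => pow_nonneg (interaction_nonneg α _) n
  rw [h.seriesTerm_eq hd hα₁ hα₂, integral_const_mul, abs_mul, abs_of_nonneg h0, abs_div, abs_pow,
    abs_neg, abs_of_nonneg hg, Nat.abs_cast]

theorem abs_seriesTerm_le_majorant (hd : 1 ≤ d) {α g : ℝ} (hα₁ : 1 ≤ α) (hα₂ : α ≤ 2) (hg : 0 ≤ g)
    {n : ℕ} (hn : 1 ≤ n) {R : ℝ} {j : FieldSpace d L} (hj : ‖j‖ ≤ R) :
    |seriesTerm G α g n j| ≤ majorant G α g n R := by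
  have hG := h.kernel_zero_nonneg
  have hL : 0 < L := Fact.out
  have hR : 0 ≤ R := (norm_nonneg j).trans hj
  set K : ℝ := Real.sqrt (2 ^ (n * α) * Real.Gamma (n * α + 1 / 2) / Real.sqrt Real.pi) with hK
  have hK0 : 0 ≤ K := Real.sqrt_nonneg _
  have h1 : ∫ ω, interaction α (freeField e lam ω) ^ n ∂tiltedNoise (sourceVec h j) ≤
      G 0 ^ (n * α / 2) * K * Real.exp (‖sourceVec h j‖ ^ 2 / 2) * (L ^ d) ^ n := by
    rw [integral_eq_lintegral_of_nonneg_ae (Eventually.of_forall fun ω =>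
      pow_nonneg (interaction_nonneg α _) n)
      (h.integrable_interaction_pow hd hα₁ hα₂ n j).aestronglyMeasurable,
      h.lintegral_interaction_pow hd hα₁ hα₂]
    exact ENNReal.toReal_le_of_le_ofReal (by positivity)
      (h.lintegral_lintegral_termIntegrand_le hd (by linarith) hn j)
  have h2 : Real.exp (‖sourceVec h j‖ ^ 2 / 2) ≤
      (1 + Real.sqrt ‖propagatorOp G‖ * R) * Real.exp ((1 / 2) * ‖propagatorOp G‖ * R ^ 2) := by
    have h3 := h.norm_sourceVec_sq_le j
    have h4 : ‖j‖ ^ 2 ≤ R ^ 2 := pow_le_pow_left₀ (norm_nonneg j) hj 2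
    have h5 : ‖propagatorOp G‖ * ‖j‖ ^ 2 ≤ ‖propagatorOp G‖ * R ^ 2 :=
      mul_le_mul_of_nonneg_left h4 (norm_nonneg _)
    have h6 : Real.exp (‖sourceVec h j‖ ^ 2 / 2) ≤
        Real.exp ((1 / 2) * ‖propagatorOp G‖ * R ^ 2) := Real.exp_le_exp.2 (by linarith)
    have h7 : (1 : ℝ) ≤ 1 + Real.sqrt ‖propagatorOp G‖ * R :=
      le_add_of_nonneg_right (by positivity)
    calc _ ≤ 1 * Real.exp ((1 / 2) * ‖propagatorOp G‖ * R ^ 2) := by rwa [one_mul]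
      _ ≤ _ := mul_le_mul_of_nonneg_right h7 (by positivity)
  have h3 := moment_le_majorantCoeff hα₁ hn
  rw [← hK] at h3
  have hc := majorantCoeff_nonneg α n
  rw [h.abs_seriesTerm hd hα₁ hα₂ hg, majorant]
  calc _ ≤ g ^ n / (n.factorial : ℝ) *
        (G 0 ^ (n * α / 2) * K * Real.exp (‖sourceVec h j‖ ^ 2 / 2) * (L ^ d) ^ n) :=
        mul_le_mul_of_nonneg_left h1 (by positivity)
    _ = (1 / (n.factorial : ℝ) * K) * g ^ n * G 0 ^ (n * α / 2) * (L ^ d) ^ n *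
        Real.exp (‖sourceVec h j‖ ^ 2 / 2) := by ring
    _ ≤ _ := by gcongr

end Diagonalizes

end Majorant

/-! ### Exponential moments and summation of the series -/

section Summation

/-- The exact value is `(1 - 2 t) ^ (-1 / 2)`; the exponential bound with a common `r` makes
products over infinitely many variables tractable. -/
theorem lintegral_exp_mul_sq_gaussianReal_le {t r : ℝ} (ht : 0 ≤ t) (htr : 2 * t ≤ r)
    (hr : r < 1) :
    ∫⁻ x, ENNReal.ofReal (Real.exp (t * x ^ 2)) ∂gaussianReal 0 1 ≤
      ENNReal.ofReal (Real.exp (t / (1 - r))) := by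
  have hb : 0 < 1 / 2 - t := by linarith
  have h1 : ∀ x : ℝ, gaussianPDF 0 1 x * ENNReal.ofReal (Real.exp (t * x ^ 2)) =
      ENNReal.ofReal ((Real.sqrt (2 * Real.pi))⁻¹ * Real.exp (-(1 / 2 - t) * x ^ 2)) := by
    intro x
    rw [gaussianPDF, ← ENNReal.ofReal_mul (gaussianPDFReal_nonneg _ _ _), gaussianPDFReal,
      mul_assoc,
      ← Real.exp_add]
    congr 2
    · simp
    · congr 1
      push_cast
      ring
  rw [gaussianReal_of_var_ne_zero _ one_ne_zero,
    lintegral_withDensity_eq_lintegral_mul _ (measurable_gaussianPDF 0 1) (by fun_prop)]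
  simp only [Pi.mul_apply, h1]
  rw [← ofReal_integral_eq_lintegral_ofReal ((integrable_exp_neg_mul_sq hb).const_mul _)
    (Eventually.of_forall fun x => by positivity), integral_const_mul, integral_gaussian]
  refine ENNReal.ofReal_le_ofReal ?_
  have h2 : (Real.sqrt (2 * Real.pi))⁻¹ * Real.sqrt (Real.pi / (1 / 2 - t)) =
      Real.sqrt (1 + 2 * t / (1 - 2 * t)) := by
    rw [← Real.sqrt_inv, ← Real.sqrt_mul (by positivity)]
    congr 1
    have : 1 - 2 * t ≠ 0 := by linarith
    have := Real.pi_pos.ne'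
    field_simp
    ring
  rw [h2]
  refine Real.sqrt_le_iff.2 ⟨by positivity, ?_⟩
  rw [← Real.exp_nat_mul]
  have h3 : 2 * t / (1 - 2 * t) ≤ 2 * t / (1 - r) :=
    div_le_div_of_nonneg_left (by positivity) (by linarith) (by linarith)
  have h4 := Real.add_one_le_exp (2 * t / (1 - r))
  have h5 : ((2 : ℕ) : ℝ) * (t / (1 - r)) = 2 * t / (1 - r) := by push_cast; ring
  rw [h5]
  linarith

theorem lintegral_tilt_rpow_le (b : SeqSpace) {q : ℝ} (hq : 0 ≤ q) :
    ∫⁻ ω, ENNReal.ofReal (tilt b ω ^ q) ∂whiteNoise ≤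
      ENNReal.ofReal (Real.exp (q ^ 2 * ‖b‖ ^ 2 / 2)) := by
  have h : ∀ ω, tilt b ω ^ q = Real.exp (-q * isonormal b ω) * Real.exp (-(q * ‖b‖ ^ 2 / 2)) := by
    intro ω
    rw [tilt, ← Real.exp_mul, ← Real.exp_add]; congr 1; ring
  simp_rw [h]
  rw [← ofReal_integral_eq_lintegral_ofReal ((integrable_exp_isonormal b (-q)).mul_const _)
    (Eventually.of_forall fun x => by positivity), integral_mul_const, integral_exp_isonormal,
    ← Real.exp_add]
  refine ENNReal.ofReal_le_ofReal (Real.exp_le_exp.2 ?_)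
  have : 0 ≤ q * ‖b‖ ^ 2 := by positivity
  rw [neg_sq]
  linarith

variable {d : ℕ} {L : ℝ} [Fact (0 < L)] {G : C(Box d L, ℝ)}
  {e : HilbertBasis ℕ ℝ (FieldSpace d L)} {lam : ℕ → ℝ}

theorem interaction_two (φ : FieldSpace d L) : interaction 2 φ = ‖φ‖ ^ 2 := by
  rw [← real_inner_self_eq_norm_sq, L2.inner_def, interaction]
  refine integral_congr_ae (Eventually.of_forall fun x => ?_)
  simp [pow_two]

namespace Diagonalizes

variable (h : Diagonalizes G e lam)
include h

/-- Exponential moments of the square of the `L²` norm of the free field, from the factorisation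
over the eigenmodes. -/
theorem lintegral_exp_norm_sq_le {s r : ℝ} (hs : 0 ≤ s) (hsr : 2 * s * ‖propagatorOp G‖ ≤ r)
    (hr : r < 1) :
    ∫⁻ ω, ENNReal.ofReal (Real.exp (s * ‖freeField e lam ω‖ ^ 2)) ∂whiteNoise ≤
      ENNReal.ofReal (Real.exp (s * (∑' k, lam k) / (1 - r))) := by
  set f : ℕ → (ℕ → ℝ) → ℝ≥0∞ := fun N ω =>
    ∏ k ∈ Finset.range N, ENNReal.ofReal (Real.exp (s * lam k * ω k ^ 2)) with hf
  have hfm : ∀ N, Measurable (f N) := fun N => by simp only [hf]; fun_prop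
  have hlim : ∀ᵐ ω ∂whiteNoise, ENNReal.ofReal (Real.exp (s * ‖freeField e lam ω‖ ^ 2)) =
      liminf (fun N => f N ω) atTop := by
    filter_upwards [h.ae_hasSum_norm_freeField_sq] with ω hω
    refine (Tendsto.liminf_eq ?_).symm
    have h1 := (hω.tendsto_sum_nat.const_mul s)
    have h2 : ∀ N, f N ω =
        ENNReal.ofReal (Real.exp (s * ∑ k ∈ Finset.range N, lam k * ω k ^ 2)) := by
      intro N
      simp only [hf]
      rw [← ENNReal.ofReal_prod_of_nonneg (fun _ _ => (Real.exp_pos _).le), ← Real.exp_sum,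
        Finset.mul_sum]
      simp only [mul_assoc]
    simp_rw [h2]
    exact ((ENNReal.continuous_ofReal.comp Real.continuous_exp).tendsto _).comp h1
  have hint : ∀ N, ∫⁻ ω, f N ω ∂whiteNoise ≤
      ENNReal.ofReal (Real.exp (s * (∑' k, lam k) / (1 - r))) := by
    intro N
    have hind : iIndepFun (fun (k : ℕ) (ω : ℕ → ℝ) =>
        ENNReal.ofReal (Real.exp (s * lam k * ω k ^ 2))) whiteNoise :=
      iIndepFun_eval_whiteNoise.comp (fun k x => ENNReal.ofReal (Real.exp (s * lam k * x ^ 2)))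
        (fun k => by fun_prop)
    simp only [hf]
    rw [lintegral_prod_eq_prod_lintegral_of_indepFun _ _ hind (fun k => by fun_prop)]
    have h1 : ∀ k, ∫⁻ ω, ENNReal.ofReal (Real.exp (s * lam k * ω k ^ 2)) ∂whiteNoise ≤
        ENNReal.ofReal (Real.exp (s * lam k / (1 - r))) := by
      intro k
      have h2 := lintegral_map (μ := whiteNoise)
        (f := fun x : ℝ => ENNReal.ofReal (Real.exp (s * lam k * x ^ 2))) (by fun_prop)
        (measurable_pi_apply k)
      rw [map_eval_whiteNoise] at h2
      rw [← h2]
      refine lintegral_exp_mul_sq_gaussianReal_le (mul_nonneg hs (h.pos k).le) ?_ hr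
      have := mul_le_mul_of_nonneg_left (h.eigenvalue_le_norm k) hs
      linarith
    refine (Finset.prod_le_prod' fun k _ => h1 k).trans ?_
    rw [← ENNReal.ofReal_prod_of_nonneg (fun _ _ => (Real.exp_pos _).le), ← Real.exp_sum]
    refine ENNReal.ofReal_le_ofReal (Real.exp_le_exp.2 ?_)
    rw [← Finset.sum_div, ← Finset.mul_sum]
    have h3 := h.summable.sum_le_tsum (Finset.range N) (fun k _ => (h.pos k).le)
    have h4 : 0 < 1 - r := by linarith
    gcongr
  rw [lintegral_congr_ae hlim]
  refine (lintegral_liminf_le hfm).trans ?_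
  exact liminf_le_of_frequently_le' (Eventually.of_forall hint).frequently

/-- The exponential moments remain bounded under the tilt, uniformly for sources in a ball, at the
price of a factor `ρ > 1` in the exponent (Hölder's inequality against the density). -/
theorem exists_lintegral_exp_norm_sq_tilted_le {s ρ : ℝ} (hs : 0 ≤ s) (hρ : 1 < ρ)
    (hr : 2 * (s * ρ) * ‖propagatorOp G‖ < 1) (R : ℝ) : ∃ K : ℝ, 0 ≤ K ∧ ∀ j : FieldSpace d L,
      ‖j‖ ≤ R → ∫⁻ ω, ENNReal.ofReal (Real.exp (s * ‖freeField e lam ω‖ ^ 2))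
        ∂tiltedNoise (sourceVec h j) ≤ ENNReal.ofReal K := by
  set q : ℝ := (1 - ρ⁻¹)⁻¹ with hq
  have hρi : 0 < 1 - ρ⁻¹ := by linarith [inv_lt_one_of_one_lt₀ hρ]
  have hq0 : 0 < q := inv_pos.2 hρi
  set C := Real.exp (s * ρ * (∑' k, lam k) / (1 - 2 * (s * ρ) * ‖propagatorOp G‖)) with hC
  refine ⟨C ^ ρ⁻¹ * Real.exp (q ^ 2 * (‖propagatorOp G‖ * R ^ 2) / 2) ^ (1 - ρ⁻¹),
    by positivity, fun j hj => ?_⟩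
  have hm : AEMeasurable (fun ω => ENNReal.ofReal (Real.exp (s * ‖freeField e lam ω‖ ^ 2)))
      whiteNoise := by
    have := h.aemeasurable_freeField
    fun_prop
  have hm2 : AEMeasurable (fun ω => ENNReal.ofReal (Real.exp (s * ρ * ‖freeField e lam ω‖ ^ 2)))
      whiteNoise := by
    have := h.aemeasurable_freeField
    fun_prop
  have hm3 : AEMeasurable (fun ω => ENNReal.ofReal (tilt (sourceVec h j) ω ^ q)) whiteNoise :=
    ((measurable_tilt _).pow_const q).ennreal_ofReal.aemeasurable
  rw [tiltedNoise, lintegral_withDensity_eq_lintegral_mul₀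
    (measurable_tilt _).ennreal_ofReal.aemeasurable hm]
  have hH := ENNReal.lintegral_mul_norm_pow_le (μ := whiteNoise) hm2 hm3
    (inv_nonneg.2 (by linarith : 0 ≤ ρ)) hρi.le (by ring)
  refine (le_of_eq (lintegral_congr fun ω => ?_)).trans (hH.trans ?_)
  · rw [ENNReal.ofReal_rpow_of_nonneg (by positivity) (by positivity),
      ENNReal.ofReal_rpow_of_nonneg (Real.rpow_nonneg (tilt_nonneg _ _) _) hρi.le, ← Real.exp_mul,
      ← Real.rpow_mul (tilt_nonneg _ _), hq, inv_mul_cancel₀ hρi.ne', Real.rpow_one, Pi.mul_apply,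
      mul_comm]
    congr 3
    field_simp
  · have h1 := h.lintegral_exp_norm_sq_le (s := s * ρ) (by positivity) le_rfl hr
    have h2 := lintegral_tilt_rpow_le (sourceVec h j) hq0.le
    have h3 := h.norm_sourceVec_sq_le j
    have h4 : ‖propagatorOp G‖ * ‖j‖ ^ 2 ≤ ‖propagatorOp G‖ * R ^ 2 :=
      mul_le_mul_of_nonneg_left (pow_le_pow_left₀ (norm_nonneg j) hj 2) (norm_nonneg _)
    have h5 : ENNReal.ofReal (Real.exp (q ^ 2 * ‖sourceVec h j‖ ^ 2 / 2)) ≤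
        ENNReal.ofReal (Real.exp (q ^ 2 * (‖propagatorOp G‖ * R ^ 2) / 2)) := by
      refine ENNReal.ofReal_le_ofReal (Real.exp_le_exp.2 ?_)
      gcongr
      linarith
    rw [ENNReal.ofReal_mul (by positivity), ← ENNReal.ofReal_rpow_of_nonneg (by positivity)
      (by positivity), ← ENNReal.ofReal_rpow_of_nonneg (by positivity) hρi.le]
    exact mul_le_mul' (ENNReal.rpow_le_rpow h1 (by positivity))
      (ENNReal.rpow_le_rpow (h2.trans h5) hρi.le)

/-- For the quadratic interaction below the critical coupling, the terms decay geometrically: a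
slightly stronger coupling `g ρ` still has finite exponential moments, and these bound
`(g ρ) ^ n / n!` times the `n`-th moment. -/
theorem exists_summable_bound_quadratic (hd : 1 ≤ d) {g : ℝ} (hg : 0 < g)
    (hgc : 2 * g * ‖propagatorOp G‖ < 1) (R : ℝ) : ∃ u : ℕ → ℝ, Summable u ∧
      ∀ (n : ℕ) (j : FieldSpace d L), ‖j‖ ≤ R → |seriesTerm G 2 g n j| ≤ u n := by
  -- two steps from `g` towards the critical coupling, by the same factor `ρ`
  obtain ⟨ρ, hρ, hρc⟩ : ∃ ρ : ℝ, 1 < ρ ∧ 2 * (g * ρ * ρ) * ‖propagatorOp G‖ < 1 := by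
    have hc : Continuous fun ρ : ℝ => 2 * (g * ρ * ρ) * ‖propagatorOp G‖ := by fun_prop
    have h1 : ∀ᶠ ρ in 𝓝 (1 : ℝ), 2 * (g * ρ * ρ) * ‖propagatorOp G‖ < 1 :=
      hc.continuousAt.eventually_lt_const (by simpa using hgc)
    obtain ⟨ρ, h2, h3⟩ := ((h1.filter_mono nhdsWithin_le_nhds).and
      (self_mem_nhdsWithin : ∀ᶠ ρ in 𝓝[>] (1 : ℝ), ρ ∈ Set.Ioi 1)).exists
    exact ⟨ρ, h3, h2⟩
  obtain ⟨K, hK0, hK⟩ := h.exists_lintegral_exp_norm_sq_tilted_le (s := g * ρ) (by positivity) hρ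
    hρc R
  have hρ0 : 0 < ρ := by linarith
  refine ⟨fun n => ρ⁻¹ ^ n * K, (summable_geometric_of_lt_one (by positivity)
    (inv_lt_one_of_one_lt₀ hρ)).mul_right K, fun n j hj => ?_⟩
  rw [h.abs_seriesTerm hd one_le_two le_rfl hg.le]
  have h1 : (g * ρ) ^ n / (n.factorial : ℝ) *
      ∫ ω, interaction 2 (freeField e lam ω) ^ n ∂tiltedNoise (sourceVec h j) ≤ K := by
    rw [← integral_const_mul, integral_eq_lintegral_of_nonneg_ae (Eventually.of_forall fun ω => by
      have := interaction_nonneg 2 (freeField e lam ω)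
      positivity) ((h.integrable_interaction_pow hd one_le_two le_rfl n
        j).const_mul _).aestronglyMeasurable]
    refine ENNReal.toReal_le_of_le_ofReal hK0 ((lintegral_mono fun ω => ?_).trans (hK j hj))
    refine ENNReal.ofReal_le_ofReal ?_
    have h2 := Real.pow_div_factorial_le_exp (g * ρ * ‖freeField e lam ω‖ ^ 2) (by positivity) n
    rw [interaction_two]
    refine (le_of_eq ?_).trans h2
    rw [mul_pow (g * ρ)]
    ring
  calc _ = ρ⁻¹ ^ n * ((g * ρ) ^ n / (n.factorial : ℝ) *
        ∫ ω, interaction 2 (freeField e lam ω) ^ n ∂tiltedNoise (sourceVec h j)) := by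
        rw [mul_pow, inv_pow]
        field_simp
    _ ≤ _ := mul_le_mul_of_nonneg_left h1 (by positivity)

theorem seriesTerm_zero (hd : 1 ≤ d) {α : ℝ} (hα₁ : 1 ≤ α) (hα₂ : α ≤ 2) (g : ℝ)
    (j : FieldSpace d L) : seriesTerm G α g 0 j = 1 := by
  rw [h.seriesTerm_eq hd hα₁ hα₂]
  simp

/-- A summable bound for the terms, uniform for sources in a ball: the majorant below the quadratic
case, and a geometric series in it. -/
theorem exists_summable_bound (hd : 1 ≤ d) {α g : ℝ} (hα₁ : 1 ≤ α) (hα₂ : α ≤ 2) (hg : 0 < g)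
    (hc : α < 2 ∨ 2 * g * ‖propagatorOp G‖ < 1) (R : ℝ) : ∃ u : ℕ → ℝ, Summable u ∧
      ∀ (n : ℕ) (j : FieldSpace d L), ‖j‖ ≤ R → |seriesTerm G α g n j| ≤ u n := by
  rcases hα₂.lt_or_eq with hα | rfl
  · refine ⟨fun n => majorant G α g n R + if n = 0 then 1 else 0,
      (summable_majorant hα₁ hα hg h.kernel_zero_nonneg R).add (hasSum_ite_eq 0 1).summable,
      fun n j hj => ?_⟩
    rcases Nat.eq_zero_or_pos n with rfl | hn
    · simp [h.seriesTerm_zero hd hα₁ hα₂, majorant, majorantCoeff]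
    · simpa [hn.ne'] using h.abs_seriesTerm_le_majorant hd hα₁ hα₂ hg.le hn hj
  · exact h.exists_summable_bound_quadratic hd hg (hc.resolve_left (lt_irrefl _)) R

/-- The source term of the weight is the tilt up to normalisation. -/
theorem weight_ae (α g : ℝ) (j : FieldSpace d L) : ∀ᵐ ω ∂whiteNoise,
    weight α g j (freeField e lam ω) = Real.exp (‖sourceVec h j‖ ^ 2 / 2) *
      (tilt (sourceVec h j) ω * Real.exp (-g * interaction α (freeField e lam ω))) := by
  filter_upwards [h.inner_freeField_ae j] with ω hω
  have h1 : ∫ x, j x * freeField e lam ω x = inner ℝ j (freeField e lam ω) := by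
    rw [L2.inner_def]
    simp [mul_comm]
  rw [weight, h1, ← hω, tilt, ← Real.exp_add, ← Real.exp_add, interaction]
  ring_nf

theorem gaussGenFunctional_eq (j : FieldSpace d L) :
    gaussGenFunctional G j = Real.exp (‖sourceVec h j‖ ^ 2 / 2) := by
  rw [gaussGenFunctional, h.norm_sourceVec_sq, inner_propagatorOp]
  simp only [mul_assoc, integral_const_mul]
  congr 1
  rw [one_div, inv_mul_eq_div]
  rfl

end Diagonalizes

theorem continuous_weight {α : ℝ} (hα₁ : 1 ≤ α) (hα₂ : α ≤ 2) (g : ℝ) (j : FieldSpace d L) :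
    Continuous (weight α g j) := by
  have h1 : weight α g j = fun φ => Real.exp (-g * interaction α φ - inner ℝ j φ) := by
    ext φ
    rw [weight, L2.inner_def, interaction]
    simp [mul_comm]
  have := continuous_interaction (d := d) (L := L) hα₁ hα₂
  rw [h1]
  fun_prop

namespace Diagonalizes

variable (h : Diagonalizes G e lam)
include h

theorem integrable_weight {α : ℝ} (hα₁ : 1 ≤ α) (hα₂ : α ≤ 2) {g : ℝ} (hg : 0 ≤ g)
    (j : FieldSpace d L) : Integrable (weight α g j) (gaussianMeasure e lam) := by
  have hc := continuous_weight (d := d) (L := L) hα₁ hα₂ g j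
  rw [gaussianMeasure_eq_map, integrable_map_measure hc.measurable.aestronglyMeasurable
    h.aemeasurable_freeField]
  refine ((integrable_tilt (sourceVec h j)).const_mul
    (Real.exp (‖sourceVec h j‖ ^ 2 / 2))).mono'
    (hc.measurable.comp_aemeasurable h.aemeasurable_freeField).aestronglyMeasurable ?_
  filter_upwards [h.weight_ae α g j] with ω hω
  have h1 : Real.exp (-g * interaction α (freeField e lam ω)) ≤ 1 := by
    rw [Real.exp_le_one_iff]
    have := interaction_nonneg α (freeField e lam ω)
    nlinarith
  have h2 := tilt_nonneg (sourceVec h j) ω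
  rw [Function.comp_apply, hω, Real.norm_of_nonneg (by positivity)]
  exact mul_le_mul_of_nonneg_left (mul_le_of_le_one_right h2 h1) (Real.exp_pos _).le

/-- The normalised generating functional is an expectation under the tilted noise. -/
theorem genFunctional_eq {α : ℝ} (hα₁ : 1 ≤ α) (hα₂ : α ≤ 2) (g : ℝ) (j : FieldSpace d L) :
    genFunctional (gaussianMeasure e lam) α g j = gaussGenFunctional G j *
      ∫ ω, Real.exp (-g * interaction α (freeField e lam ω)) ∂tiltedNoise (sourceVec h j) := by
  have hc := continuous_weight (d := d) (L := L) hα₁ hα₂ g j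
  rw [genFunctional, gaussianMeasure_eq_map, integral_map h.aemeasurable_freeField
    hc.measurable.aestronglyMeasurable, integral_congr_ae (h.weight_ae α g j), integral_const_mul,
    h.gaussGenFunctional_eq, tiltedNoise, integral_withDensity_eq_integral_toReal_smul
      (measurable_tilt _).ennreal_ofReal (Eventually.of_forall fun _ => ENNReal.ofReal_lt_top)]
  simp only [ENNReal.toReal_ofReal (tilt_nonneg _ _), smul_eq_mul]

/-- Expansion of the exponential under the expectation; the interchange is justified by the summable
bound for the terms, since all moments are nonnegative. -/
theorem hasSum_seriesTerm (hd : 1 ≤ d) {α g : ℝ} (hα₁ : 1 ≤ α) (hα₂ : α ≤ 2) (hg : 0 < g)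
    (hc : α < 2 ∨ 2 * g * ‖propagatorOp G‖ < 1) (j : FieldSpace d L) :
    HasSum (fun n : ℕ => seriesTerm G α g n j)
      (genFunctional (gaussianMeasure e lam) α g j / gaussGenFunctional G j) := by
  obtain ⟨u, hu, hub⟩ := h.exists_summable_bound hd hα₁ hα₂ hg hc ‖j‖
  rw [h.genFunctional_eq hα₁ hα₂, mul_div_cancel_left₀ _ (by
    rw [h.gaussGenFunctional_eq]; positivity)]
  set F : ℕ → (ℕ → ℝ) → ℝ := fun n ω =>
    (-g) ^ n / (n.factorial : ℝ) * interaction α (freeField e lam ω) ^ n with hF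
  have hi : ∀ n, Integrable (F n) (tiltedNoise (sourceVec h j)) := fun n =>
    (h.integrable_interaction_pow hd hα₁ hα₂ n j).const_mul _
  have hs : Summable fun n => ∫ ω, ‖F n ω‖ ∂tiltedNoise (sourceVec h j) := by
    refine Summable.of_nonneg_of_le (fun n => by positivity) (fun n => ?_) hu
    refine le_trans (le_of_eq ?_) (hub n j le_rfl)
    rw [h.abs_seriesTerm hd hα₁ hα₂ hg.le, ← integral_const_mul]
    refine integral_congr_ae (Eventually.of_forall fun ω => ?_)
    have := interaction_nonneg α (freeField e lam ω)
    simp only [hF, norm_mul, norm_div, norm_pow, norm_neg, Real.norm_of_nonneg this,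
      Real.norm_of_nonneg hg.le, Real.norm_natCast]
  have h1 := hasSum_integral_of_summable_integral_norm hi hs
  simp only [hF] at h1
  simp only [← h.seriesTerm_eq hd hα₁ hα₂] at h1
  have h2 : ∀ ω : ℕ → ℝ, Real.exp (-g * interaction α (freeField e lam ω)) =
      ∑' n : ℕ, (-g) ^ n / (n.factorial : ℝ) * interaction α (freeField e lam ω) ^ n := fun ω => by
    rw [Real.exp_eq_exp_ℝ, NormedSpace.exp_eq_tsum_div]
    refine tsum_congr fun n => ?_
    rw [mul_pow]
    ring
  simp only [h2]
  exact h1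

theorem tendstoUniformlyOn_seriesTerm (hd : 1 ≤ d) {α g : ℝ} (hα₁ : 1 ≤ α) (hα₂ : α ≤ 2)
    (hg : 0 < g) (hc : α < 2 ∨ 2 * g * ‖propagatorOp G‖ < 1) {B : Set (FieldSpace d L)}
    (hB : Bornology.IsBounded B) :
    TendstoUniformlyOn (fun (N : ℕ) (j : FieldSpace d L) =>
        ∑ n ∈ Finset.range N, seriesTerm G α g n j)
      (fun j => genFunctional (gaussianMeasure e lam) α g j / gaussGenFunctional G j) atTop B := by
  obtain ⟨R, hR⟩ := hB.exists_norm_le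
  obtain ⟨u, hu, hub⟩ := h.exists_summable_bound hd hα₁ hα₂ hg hc R
  refine (tendstoUniformlyOn_tsum_nat hu fun n j hj => hub n j (hR j hj)).congr_right fun j _ => ?_
  exact (h.hasSum_seriesTerm hd hα₁ hα₂ hg hc j).tsum_eq

end Diagonalizes

end Summation

end FractionalQFT

end

theorem mainTheorem1 (d : ℕ) (hd : 1 ≤ d) (L : ℝ) [Fact (0 < L)]
    (G : C(FractionalQFT.Box d L, ℝ))
    (e : HilbertBasis ℕ ℝ (FractionalQFT.FieldSpace d L)) (lam : ℕ → ℝ)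
    (hlam_pos : ∀ k, 0 < lam k) (hlam_sum : Summable lam)
    (heig : ∀ k, FractionalQFT.propagatorOp G (e k) = lam k • e k)
    (α g : ℝ) (hα₁ : 1 ≤ α) (hα₂ : α ≤ 2) (hg : 0 < g) :
    -- the functional integrals converge, and `Z₀` is the one without interaction
    (∀ j, Integrable (FractionalQFT.weight α g j) (FractionalQFT.gaussianMeasure e lam)) ∧
    (∀ j, Integrable (FractionalQFT.weight α 0 j) (FractionalQFT.gaussianMeasure e lam) ∧
      FractionalQFT.genFunctional (FractionalQFT.gaussianMeasure e lam) α 0 j =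
        FractionalQFT.gaussGenFunctional G j) ∧
    -- every term of the series is well defined, as an absolutely convergent integral
    (∀ n : ℕ, ∀ᵐ x : Fin n → FractionalQFT.Box d L, (FractionalQFT.covMatrix G x).PosDef) ∧
    (∀ (n : ℕ) (j : FractionalQFT.FieldSpace d L),
      Integrable (fun p : (Fin n → FractionalQFT.Box d L) × (Fin n → ℝ) =>
        FractionalQFT.termIntegrand G α j p.1 p.2)) ∧
    -- the explicit majorant dominates the series term by term
    (∀ j, FractionalQFT.seriesTerm G α g 0 j = 1) ∧
    (∀ (n : ℕ) (R : ℝ) (j : FractionalQFT.FieldSpace d L), 1 ≤ n → ‖j‖ ≤ R →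
      |FractionalQFT.seriesTerm G α g n j| ≤ FractionalQFT.majorant G α g n R) ∧
    (∃ A : ℝ, 0 < A ∧ ∀ n : ℕ, 1 ≤ n →
      FractionalQFT.majorantCoeff α n ≤ A ^ n * (n : ℝ) ^ (n * α / 2 - n)) ∧
    (α < 2 → ∀ R : ℝ, Summable fun n : ℕ => FractionalQFT.majorant G α g n R) ∧
    -- the series converges to `Z[j] / Z₀[j]`, uniformly on bounded sets of sources
    (α < 2 ∨ 2 * g * ‖FractionalQFT.propagatorOp G‖ < 1 →
      (∀ j, HasSum (fun n : ℕ => FractionalQFT.seriesTerm G α g n j)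
        (FractionalQFT.genFunctional (FractionalQFT.gaussianMeasure e lam) α g j /
          FractionalQFT.gaussGenFunctional G j)) ∧
      ∀ B : Set (FractionalQFT.FieldSpace d L), Bornology.IsBounded B →
        TendstoUniformlyOn
          (fun (N : ℕ) (j : FractionalQFT.FieldSpace d L) =>
            ∑ n ∈ Finset.range N, FractionalQFT.seriesTerm G α g n j)
          (fun j => FractionalQFT.genFunctional (FractionalQFT.gaussianMeasure e lam) α g j /
            FractionalQFT.gaussGenFunctional G j)
          atTop B) := by
  have h : FractionalQFT.Diagonalizes G e lam := ⟨hlam_pos, hlam_sum, heig⟩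
  refine ⟨fun j => h.integrable_weight hα₁ hα₂ hg.le j,
    fun j => ⟨h.integrable_weight hα₁ hα₂ le_rfl j, ?_⟩, h.ae_posDef_covMatrix hd,
    fun n j => h.integrable_termIntegrand hd hα₁ hα₂ n j,
    fun j => h.seriesTerm_zero hd hα₁ hα₂ g j,
    fun n R j hn hj => h.abs_seriesTerm_le_majorant hd hα₁ hα₂ hg.le hn hj,
    FractionalQFT.exists_majorantCoeff_le hα₁,
    fun hα R => FractionalQFT.summable_majorant hα₁ hα hg h.kernel_zero_nonneg R,
    fun hc => ⟨h.hasSum_seriesTerm hd hα₁ hα₂ hg hc,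
      fun B hB => h.tendstoUniformlyOn_seriesTerm hd hα₁ hα₂ hg hc hB⟩⟩
  rw [h.genFunctional_eq hα₁ hα₂]
  simp
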